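/- **Theorem 1.5.** Let $n\ge 1$ be an integer, $\nu_1\ge 0$, $\nu_2<0$, $\beta>1$, and consider the Cauchy problem $$w_{tt}-\Delta w+\frac{\nu_1}{(1+t)^{\beta}}w_t+\frac{\nu_2}{(1+t)^2}w=|w|^p \ \text{ in } \mathbb{R}^n\times(0,T),\qquad w(x,0)=\varepsilon f(x),\quad w_t(x,0)=\varepsilon g(x). \tag{1}$$ Notation: $\gamma_F(p,\nu)=2-\nu(p-1)$, $\gamma_S(p,\nu)=2+(\nu+1)p-(\nu-1)p^2$; $p_F(\nu)=1+\frac2\nu$ if $\nu>0$ and $p_F(\nu)=+\infty$ if $\nu\le0$; $p_S(\nu)=\frac{\nu+1+\sqrt{\nu^2+10\nu-7}}{2(\nu-1)}$ if $\nu>1$ and $p_S(\nu)=+\infty$ if $\nu\le1$. An *energy solution* of (1) on $[0,T)$, $0<T\le\infty$, is a function $w\in C([0,T),H^1(\mathbb{R}^n))\cap C^1([0,T),L^2(\mathbb{R}^n))\cap C((0,T),L^p_{loc}(\mathbb{R}^n))$ with $w(\cdot,0)=\varepsilon f$ in $H^1$, $w_t(\cdot,0)=\varepsilon g$ in $L^2$,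 such that for every $\phi\in C_0^\infty(\mathbb{R}^n\times[0,T))$ and every $t\in[0,T)$ the integral $\int_0^t\!\int_{\mathbb{R}^n}|w|^p\phi\,dx\,ds$ converges and $$\int_{\mathbb{R}^n} w_t(x,t)\phi(x,t)\,dx+\int_0^t\!\!\int_{\mathbb{R}^n}\{-w_t\phi_t+\nabla w\cdot\nabla\phi\}\,dx\,ds+\int_0^t\!\!\int_{\mathbb{R}^n}\frac{\nu_1}{(1+s)^\beta}w_t\phi\,dx\,ds+\int_0^t\!\!\int_{\mathbb{R}^n}\frac{\nu_2}{(1+s)^2}w\phi\,dx\,ds=\int_{\mathbb{R}^n}\varepsilon g(x)\phi(x,0)\,dx+\int_0^t\!\!\int_{\mathbb{R}^n}|w|^p\phi\,dx\,ds .$$ Set $$\delta:=1-4\nu_2e^{\nu_1/(1-\beta)},\qquad d_*(n):=\tfrac12\left(-1-n+\sqrt{n^2+10n-7}\right),\qquad p_\delta(n):=\max\left\{p_F\!\left(n-\tfrac{1+\sqrt\delta}{2}\right),\,p_S(n)\right\}.$$ Then $\delta>1$, $d_*(n)\in[0,2)$, and $$p_\delta(n)=\begin{cases}p_S(n)&\text{if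 } n\ge2,\ \sqrt\delta\le n-d_*(n),\\ p_F\!\left(n-\frac{1+\sqrt\delta}{2}\right)&\text{if } n\ge2,\ n-d_*(n)<\sqrt\delta<2n-1,\\ +\infty&\text{if } n=1, \text{ or if } n\ge2,\ \sqrt\delta\ge2n-1.\end{cases}$$ Moreover, let $1<p<p_\delta(n)$, let $f\in H^1(\mathbb{R}^n)$ and $g\in L^2(\mathbb{R}^n)$ be non-negative and not both vanishing, and let $R\ge1$. Let $T_\varepsilon$ be the blow-up time of (1), i.e. the supremum of all $T\in(0,\infty]$ for which (1) has an energy solution $w$ on $[0,T)$ with $\operatorname{supp}w\subset\{(x,t)\in\mathbb{R}^n\times[0,\infty):|x|\le t+R\}$ (with $T_\varepsilon=0$ if there is none). Then there are constants $\varepsilon_5>0$ and $C>0$, depending only on $f,g,\beta,\nu_1,\nu_2,n,p,R$, such that for all $0<\varepsilon\le\varepsilon_5$: * if $\sqrt\delta\le n-2$, then $T_\varepsilon\le C\,\varepsilon^{-2p(p-1)/\gamma_S(p,n)}$; * if $n-2<\sqrt\delta<n-d_*(n)$, then $$T_\varepsilon\le\begin{cases}C\,\varepsilon^{-(p-1)/\gamma_F(p,n-(1+\sqrt\delta)/2)}&\text{if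 } 1<p\le\frac{2}{n-\sqrt\delta},\\ C\,\varepsilon^{-2p(p-1)/\gamma_S(p,n)}&\text{if } \frac{2}{n-\sqrt\delta}<p<p_\delta(n);\end{cases}$$ * if $\sqrt\delta\ge n-d_*(n)$, then $T_\varepsilon\le C\,\varepsilon^{-(p-1)/\gamma_F(p,n-(1+\sqrt\delta)/2)}$, where $\varepsilon^{-(p-1)/\gamma_F(p,n-(1+\sqrt\delta)/2)}=\varepsilon^{-\left[2/(p-1)-n+(1+\sqrt\delta)/2\right]^{-1}}$. -/

import Mathlib

open MeasureTheory Set Filter Topology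
open scoped ENNReal ContDiff

noncomputable section

namespace NegMass

/-! ### Exponents -/

/-- The Fujita exponent `p_F(ν)`, with value `+∞` for `ν ≤ 0`. -/
def pF (ν : ℝ) : EReal :=
  if 0 < ν then ((1 + 2 / ν : ℝ) : EReal) else ⊤

/-- The Strauss exponent `p_S(ν)`, with value `+∞` for `ν ≤ 1`. -/
def pS (ν : ℝ) : EReal :=
  if 1 < ν then (((ν + 1 + √(ν ^ 2 + 10 * ν - 7)) / (2 * (ν - 1)) : ℝ) : EReal) else ⊤

/-- `γ_F(p, ν) = 2 - ν (p - 1)`. -/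
def gammaF (p ν : ℝ) : ℝ := 2 - ν * (p - 1)

/-- `γ_S(p, ν) = 2 + (ν + 1) p - (ν - 1) p²`. -/
def gammaS (p ν : ℝ) : ℝ := 2 + (ν + 1) * p - (ν - 1) * p ^ 2

/-- `δ = 1 - 4 ν₂ e^{ν₁ / (1 - β)}`. -/
def delta (ν₁ ν₂ β : ℝ) : ℝ := 1 - 4 * ν₂ * Real.exp (ν₁ / (1 - β))

/-- `d_*(n) = (-1 - n + √(n² + 10 n - 7)) / 2`. -/
def dStar (n : ℝ) : ℝ := (-1 - n + √(n ^ 2 + 10 * n - 7)) / 2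

/-- `p_δ(n) = max {p_F(n - (1 + √δ) / 2), p_S(n)}`. -/
def pDelta (δ n : ℝ) : EReal := max (pF (n - (1 + √δ) / 2)) (pS n)

/-! ### Function spaces -/

/-- The Euclidean space `ℝⁿ`. -/
abbrev Space (n : ℕ) := EuclideanSpace ℝ (Fin n)

/-- Real-valued `L²(ℝⁿ)`. -/
abbrev L2 (n : ℕ) := Lp ℝ 2 (volume : Measure (Space n))

/-- Vector fields in `L²(ℝⁿ; ℝⁿ)`. -/
abbrev L2Vec (n : ℕ) := Lp (Space n) 2 (volume : Measure (Space n))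

/-- `G` is the weak (distributional) gradient of `u`:
`∫ u ∂ₑφ = - ∫ ⟨G, e⟩ φ` for all `φ ∈ C_c^∞(ℝⁿ)` and all directions `e`. -/
def IsWeakGradient {n : ℕ} (u : L2 n) (G : L2Vec n) : Prop :=
  ∀ φ : Space n → ℝ, ContDiff ℝ ∞ φ → HasCompactSupport φ → ∀ e : Space n,
    ∫ x, u x * fderiv ℝ φ x e = -∫ x, inner ℝ (G x) e * φ x

lemma integrable_mul_test {n : ℕ} (u : L2 n) {ψ : Space n → ℝ} (hψ : Continuous ψ)
    (hc : HasCompactSupport ψ) : Integrable (fun x => u x * ψ x) :=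
  (Lp.memLp u).integrable_mul (q := 2) (hψ.memLp_of_hasCompactSupport hc)

lemma integrable_inner_mul_test {n : ℕ} (G : L2Vec n) (e : Space n) {ψ : Space n → ℝ}
    (hψ : Continuous ψ) (hc : HasCompactSupport ψ) :
    Integrable (fun x => inner ℝ (G x) e * ψ x) :=
  ((Lp.memLp G).inner_const e).integrable_mul (q := 2) (hψ.memLp_of_hasCompactSupport hc)

/-- The Sobolev space `H¹(ℝⁿ)`: pairs `(u, ∇u)` of an `L²` function and its weak gradient, where
the gradient is in `L²`. Since the gradient is determined by `u`, this is the usual space, and the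
topology inherited from `L² × L²` is the one given by the `H¹` norm. -/
def H1 (n : ℕ) : Submodule ℝ (L2 n × L2Vec n) where
  carrier := {q | IsWeakGradient q.1 q.2}
  zero_mem' := by
    intro φ _ _ e
    have h1 : (fun x => ((0 : L2 n × L2Vec n).1 : Space n → ℝ) x * fderiv ℝ φ x e)
        =ᵐ[volume] fun _ => (0 : ℝ) := by
      filter_upwards [Lp.coeFn_zero ℝ 2 (volume : Measure (Space n))] with x hx
      simp
    have h2 : (fun x => inner ℝ (((0 : L2 n × L2Vec n).2 : Space n → Space n) x) e * φ x)
        =ᵐ[volume] fun _ => (0 : ℝ) := by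
      filter_upwards [Lp.coeFn_zero (Space n) 2 (volume : Measure (Space n))] with x hx
      simp
    rw [integral_congr_ae h1, integral_congr_ae h2]
    simp
  add_mem' := by
    intro a b ha hb φ hφ hc e
    have hd : Continuous fun x => fderiv ℝ φ x e :=
      (hφ.continuous_fderiv (by simp)).clm_apply continuous_const
    have hdc : HasCompactSupport fun x => fderiv ℝ φ x e := hc.fderiv_apply ℝ e
    have h1 : (fun x => ((a + b).1 : Space n → ℝ) x * fderiv ℝ φ x e)
        =ᵐ[volume] fun x => a.1 x * fderiv ℝ φ x e + b.1 x * fderiv ℝ φ x e := by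
      filter_upwards [Lp.coeFn_add a.1 b.1] with x hx
      simp only [Prod.fst_add, hx, Pi.add_apply, add_mul]
    have h2 : (fun x => inner ℝ (((a + b).2 : Space n → Space n) x) e * φ x)
        =ᵐ[volume] fun x => inner ℝ (a.2 x) e * φ x + inner ℝ (b.2 x) e * φ x := by
      filter_upwards [Lp.coeFn_add a.2 b.2] with x hx
      simp only [Prod.snd_add, hx, Pi.add_apply, inner_add_left, add_mul]
    rw [integral_congr_ae h1, integral_congr_ae h2,
      integral_add (integrable_mul_test _ hd hdc) (integrable_mul_test _ hd hdc),
      integral_add (integrable_inner_mul_test _ e hφ.continuous hc)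
        (integrable_inner_mul_test _ e hφ.continuous hc),
      ha φ hφ hc e, hb φ hφ hc e, neg_add]
  smul_mem' := by
    intro c a ha φ hφ hc e
    have h1 : (fun x => ((c • a).1 : Space n → ℝ) x * fderiv ℝ φ x e)
        =ᵐ[volume] fun x => c * (a.1 x * fderiv ℝ φ x e) := by
      filter_upwards [Lp.coeFn_smul c a.1] with x hx
      simp only [Prod.smul_fst, hx, Pi.smul_apply, smul_eq_mul, mul_assoc]
    have h2 : (fun x => inner ℝ (((c • a).2 : Space n → Space n) x) e * φ x)
        =ᵐ[volume] fun x => c * (inner ℝ (a.2 x) e * φ x) := by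
      filter_upwards [Lp.coeFn_smul c a.2] with x hx
      simp only [Prod.smul_snd, hx, Pi.smul_apply, real_inner_smul_left, mul_assoc]
    rw [integral_congr_ae h1, integral_congr_ae h2, integral_const_mul, integral_const_mul,
      ha φ hφ hc e, mul_neg]

/-- The underlying `L²` function of an element of `H¹`. -/
def fn {n : ℕ} (f : H1 n) : L2 n := f.1.1

/-- The weak gradient of an element of `H¹`. -/
def grad {n : ℕ} (f : H1 n) : L2Vec n := f.1.2

/-! ### Energy solutions -/

/-- The time interval `[0, T)`, where `0 < T ≤ ∞`. -/
def timeInterval (T : ℝ≥0∞) : Set ℝ := {t | 0 ≤ t ∧ ENNReal.ofReal t < T}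

/-- The time derivative in `L²` of a curve on `[0, T)` (one-sided at `t = 0`). -/
def timeDeriv {n : ℕ} (T : ℝ≥0∞) (w : ℝ → H1 n) (t : ℝ) : L2 n :=
  derivWithin (fun s => fn (w s)) (timeInterval T) t

/-- The test functions `C_0^∞(ℝⁿ × [0, T))`, written with the time variable first: restrictions to
`t ≥ 0` of smooth functions on space-time whose support is compact and lies in `t < T`; they need
not vanish at `t = 0`. -/
def IsTestFunction {n : ℕ} (T : ℝ≥0∞) (φ : ℝ × Space n → ℝ) : Prop :=
  ContDiff ℝ ∞ φ ∧ HasCompactSupport φ ∧ ∀ z ∈ tsupport φ, ENNReal.ofReal z.1 < T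

/-- `w` is an energy solution on `[0, T)` of
`w_tt - Δw + ν₁ (1+t)^{-β} w_t + ν₂ (1+t)^{-2} w = |w|^p`, `w(0) = ε f`, `w_t(0) = ε g`. -/
structure IsEnergySolution {n : ℕ} (ν₁ ν₂ β p ε : ℝ) (f : H1 n) (g : L2 n) (T : ℝ≥0∞)
    (w : ℝ → H1 n) : Prop where
  pos : 0 < T
  /-- `w ∈ C([0,T), H¹)` -/
  continuousOn : ContinuousOn w (timeInterval T)
  /-- `w ∈ C¹([0,T), L²)` -/
  contDiffOn : ContDiffOn ℝ 1 (fun t => fn (w t)) (timeInterval T)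
  /-- `w(t) ∈ L^p_loc` for `t ∈ (0,T)` -/
  memLp_loc : ∀ t ∈ timeInterval T, 0 < t → ∀ K : Set (Space n), IsCompact K →
    MemLp (fn (w t)) (ENNReal.ofReal p) (volume.restrict K)
  /-- `w ∈ C((0,T), L^p_loc)` -/
  continuous_loc : ∀ t ∈ timeInterval T, 0 < t → ∀ K : Set (Space n), IsCompact K →
    Tendsto (fun s => eLpNorm (fun x => fn (w s) x - fn (w t) x) (ENNReal.ofReal p)
      (volume.restrict K)) (𝓝[timeInterval T] t) (𝓝 0)
  init : w 0 = ε • f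
  init_deriv : timeDeriv T w 0 = ε • g
  /-- The space-time integral of the nonlinear term in the weak formulation is a convergent one
  up to the initial time. -/
  integrable : ∀ φ : ℝ × Space n → ℝ, IsTestFunction T φ → ∀ t ∈ timeInterval T,
    IntervalIntegrable (fun s => ∫ x, |fn (w s) x| ^ p * φ (s, x)) volume 0 t
  /-- The weak formulation. -/
  weak : ∀ φ : ℝ × Space n → ℝ, IsTestFunction T φ → ∀ t ∈ timeInterval T,
    (∫ x, timeDeriv T w t x * φ (t, x))
      + (∫ s in (0 : ℝ)..t, ∫ x,
          (-(timeDeriv T w s x * deriv (fun r => φ (r, x)) s)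
            + fderiv ℝ (fun y => φ (s, y)) x (grad (w s) x)))
      + (∫ s in (0 : ℝ)..t, ∫ x, ν₁ / (1 + s) ^ β * timeDeriv T w s x * φ (s, x))
      + (∫ s in (0 : ℝ)..t, ∫ x, ν₂ / (1 + s) ^ 2 * fn (w s) x * φ (s, x))
    = (∫ x, ε * g x * φ (0, x))
      + ∫ s in (0 : ℝ)..t, ∫ x, |fn (w s) x| ^ p * φ (s, x)

/-- `supp w ⊆ {(x, t) : |x| ≤ t + R}` for a curve `w` on `[0, T)`. -/
def SupportedInCone {n : ℕ} (R : ℝ) (T : ℝ≥0∞) (w : ℝ → H1 n) : Prop :=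
  ∀ t ∈ timeInterval T, ∀ᵐ x : Space n, t + R < ‖x‖ → fn (w t) x = 0

/-- The blow-up time (lifespan) `T_ε`: the supremum of all `T ∈ (0, ∞]` such that there is an energy
solution on `[0, T)` with support in the cone `|x| ≤ t + R`. -/
def lifespan {n : ℕ} (ν₁ ν₂ β p R ε : ℝ) (f : H1 n) (g : L2 n) : ℝ≥0∞ :=
  sSup {T | ∃ w : ℝ → H1 n,
    IsEnergySolution ν₁ ν₂ β p ε f g T w ∧ SupportedInCone R T w}

end NegMass

end

noncomputable section

namespace NegMass

/-! ### Exponents -/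

/-! Up to the non-negative source |w|^p the equation is linear, so it is tested with e^{x·ξ}. The
support condition makes a cut-off of this exponential exact, and G(t) = ∫ w e^{x·ξ} dx obeys, in
integrated form, G'' + ν₁(1+t)^{-β} G' = (|ξ|² − ν₂(1+t)^{-2}) G + N with N = ∫ |w|^p e^{x·ξ} dx ≥ 0
(`isMoment_of_isEnergySolution`). The multiplier `damp` absorbs the friction. Since β > 1 it stays
between its initial value m₀ = e^{ν₁/(1−β)} and 1, so only constants are lost and one-dimensional
comparison arguments suffice.

There are two lower bounds for the mass, the moment with ξ = 0. First, its equation is of Euler type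
with growth exponent k = (1+√δ)/2, because k(k−1) = −ν₂ m₀; this gives mass ≥ c ε (1+t)^k
(`rpow_le_of_mass`). Second, for 1 ≤ |ξ| ≤ 2 the moments grow like ε e^{|ξ|t} (`exp_le_of_wave`).
Hölder's inequality and integration over a set of such frequencies turn this into ∫ |w|^p ≥ c ε^p
t^{(n−1)(2−p)/2} (`le_integral_abs_rpow_of_exp`), and two time integrations give mass ≥ c ε^p
t^{(n−1)(2−p)/2+2}.

Hölder on the ball of radius t+R also gives N ≥ c (1+t)^{-n(p−1)} G^p for the mass. If G ≥ B t^a,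
this superlinear feedback forces t ≤ C B^{-(p−1)/Γ} provided Γ = 2 − n(p−1) + a(p−1) > 0
(`time_le_of_superlinear`). The two growth rates yield Γ = γ_F(p, n−k) with B ~ ε, and Γ = γ_S(p,
n)/2 with B ~ ε^p, which are the two lifespan bounds.

The case distinction comes from γ_S − 2pγ_F = (p−1)(p(n−√δ)−2) (`gammaS_sub_gammaF`): below p_δ(n)
at least one of γ_F, γ_S is positive, and the sign of p(n−√δ)−2 tells which of the two is certain to
be. -/

lemma one_lt_delta {ν₁ ν₂ β : ℝ} (hν₂ : ν₂ < 0) : 1 < delta ν₁ ν₂ β := by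
  have := Real.exp_pos (ν₁ / (1 - β))
  unfold delta
  nlinarith

lemma dStar_mem {n : ℝ} (hn : 1 ≤ n) : 0 ≤ dStar n ∧ dStar n < 2 := by
  unfold dStar
  have h1 : n + 1 ≤ √(n ^ 2 + 10 * n - 7) := Real.le_sqrt_of_sq_le (by nlinarith)
  have h2 : √(n ^ 2 + 10 * n - 7) < n + 5 := (Real.sqrt_lt' (by linarith)).2 (by nlinarith)
  constructor <;> linarith

/-- This quadratic equation for d expresses that the Fujita and Strauss exponents coincide at √δ = n
− d; see `pS_eq`. -/
lemma dStar_sq {n : ℝ} (hn : 1 ≤ n) : dStar n ^ 2 + (n + 1) * dStar n = 2 * (n - 1) := by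
  have h : √(n ^ 2 + 10 * n - 7) ^ 2 = n ^ 2 + 10 * n - 7 := Real.sq_sqrt (by nlinarith)
  unfold dStar
  linear_combination h / 4

/-- With the Strauss exponent written as a Fujita exponent at √δ = n − d_*(n), comparing the two
members of the maximum reduces to monotonicity of ν ↦ 1 + 2/ν. -/
lemma pS_eq {n : ℝ} (hn : 1 < n) :
    pS n = ((1 + 2 / (n - (1 + (n - dStar n)) / 2) : ℝ) : EReal) := by
  have hd := (dStar_mem hn.le).1
  have h2 := dStar_sq hn.le
  have hs : √(n ^ 2 + 10 * n - 7) = 2 * dStar n + n + 1 := by unfold dStar; ring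
  rw [pS, if_pos hn, hs]
  norm_cast
  have h3 : n - 1 ≠ 0 := by linarith
  have h4 : n - (1 + (n - dStar n)) / 2 ≠ 0 := by linarith
  field_simp
  have h5 : n * 2 - (1 + (n - dStar n)) ≠ 0 := by linarith
  first | linear_combination 2 * h2 | (field_simp; linear_combination 2 * h2)

lemma pDelta_eq_pS {n δ : ℝ} (hn : 1 < n) (h : √δ ≤ n - dStar n) : pDelta δ n = pS n := by
  have hd := (dStar_mem hn.le).1
  rw [pDelta, max_eq_right]
  have h0 : 0 < n - (1 + √δ) / 2 := by linarith
  rw [pS_eq hn, pF, if_pos h0]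
  norm_cast
  have : 0 < n - (1 + (n - dStar n)) / 2 := by linarith
  gcongr

lemma pDelta_eq_pF {n δ : ℝ} (hn : 1 < n) (h : n - dStar n < √δ) (h' : √δ < 2 * n - 1) :
    pDelta δ n = pF (n - (1 + √δ) / 2) := by
  rw [pDelta, max_eq_left]
  have h0 : 0 < n - (1 + √δ) / 2 := by linarith
  rw [pS_eq hn, pF, if_pos h0]
  norm_cast
  gcongr

lemma pDelta_eq_top {n δ : ℝ} (h : n ≤ 1 ∨ 2 * n - 1 ≤ √δ) : pDelta δ n = ⊤ := by
  rcases h with h | h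
  · rw [pDelta, pS, if_neg h.not_gt, max_eq_right le_top]
  · rw [pDelta, pF, if_neg (by linarith), max_eq_left le_top]

lemma gammaF_pos {p ν : ℝ} (hp : 1 < p) (h : (p : EReal) < pF ν) : 0 < gammaF p ν := by
  unfold gammaF
  unfold pF at h
  split_ifs at h with hν
  · have h := EReal.coe_lt_coe_iff.1 h
    have : p - 1 < 2 / ν := by linarith
    rw [lt_div_iff₀ hν] at this
    linarith
  · nlinarith

lemma gammaS_pos {p ν : ℝ} (hν1 : 1 ≤ ν) (hp : 1 < p) (h : (p : EReal) < pS ν) :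
    0 < gammaS p ν := by
  unfold gammaS
  unfold pS at h
  split_ifs at h with hν
  · have h := EReal.coe_lt_coe_iff.1 h
    rw [lt_div_iff₀ (by linarith)] at h
    have h1 : √(ν ^ 2 + 10 * ν - 7) ^ 2 = ν ^ 2 + 10 * ν - 7 := Real.sq_sqrt (by nlinarith)
    have h2 : ν + 1 ≤ √(ν ^ 2 + 10 * ν - 7) := Real.le_sqrt_of_sq_le (by nlinarith)
    have h3 : 0 < p * (2 * (ν - 1)) := by apply mul_pos <;> linarith
    have h4 : 0 < p * (2 * (ν - 1)) - (ν + 1) + √(ν ^ 2 + 10 * ν - 7) := by linarith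
    -- Completing the square in p: this product of conjugate factors is 4(ν−1)γ_S(p, ν).
    have h5 := mul_pos h4 (sub_pos.2 h)
    have h6 : 0 < 4 * (ν - 1) * (2 + (ν + 1) * p - (ν - 1) * p ^ 2) := by nlinarith
    exact (mul_pos_iff_of_pos_left (by linarith)).1 h6
  · nlinarith

/-- The sign of the right side compares the heat exponent (p−1)/γ_F with the wave exponent
2p(p−1)/γ_S. Whichever of 2pγ_F and γ_S is larger inherits positivity from the other. -/
lemma gammaS_sub_gammaF (p n σ : ℝ) :
    gammaS p n - 2 * p * gammaF p (n - (1 + σ) / 2) = (p - 1) * (p * (n - σ) - 2) := by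
  unfold gammaS gammaF
  ring

lemma gammaF_pos_of_lt_pDelta {p n δ : ℝ} (hn : 1 ≤ n) (hp : 1 < p)
    (h : (p : EReal) < pDelta δ n) (h' : p * (n - √δ) ≤ 2) :
    0 < gammaF p (n - (1 + √δ) / 2) := by
  rcases lt_max_iff.1 h with h | h
  · exact gammaF_pos hp h
  · have h1 := gammaS_pos hn hp h
    have h2 := gammaS_sub_gammaF p n √δ
    have h3 : (p - 1) * (p * (n - √δ) - 2) ≤ 0 :=
      mul_nonpos_of_nonneg_of_nonpos (by linarith) (by linarith)
    have h4 : 0 < 2 * p * gammaF p (n - (1 + √δ) / 2) := by linarith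
    exact (mul_pos_iff_of_pos_left (by linarith)).1 h4

lemma gammaS_pos_of_lt_pDelta {p n δ : ℝ} (hn : 1 ≤ n) (hp : 1 < p)
    (h : (p : EReal) < pDelta δ n) (h' : 2 ≤ p * (n - √δ)) : 0 < gammaS p n := by
  rcases lt_max_iff.1 h with h | h
  · have h1 := gammaF_pos hp h
    have h2 := gammaS_sub_gammaF p n √δ
    have h3 : 0 ≤ (p - 1) * (p * (n - √δ) - 2) := mul_nonneg (by linarith) (by linarith)
    have h4 : 0 < 2 * p * gammaF p (n - (1 + √δ) / 2) := by positivity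
    linarith
  · exact gammaS_pos hn hp h

/-- In this range the maximum is attained by the Fujita exponent. Once √δ ≥ 2n−1 the shifted
dimension is non-positive and γ_F ≥ 2 outright. -/
lemma gammaF_pos_of_le_sqrt {p n δ : ℝ} (hn : 1 ≤ n) (hp : 1 < p)
    (h : (p : EReal) < pDelta δ n) (h' : n - dStar n ≤ √δ) :
    0 < gammaF p (n - (1 + √δ) / 2) := by
  by_cases h2 : 2 * n - 1 ≤ √δ
  · have : (n - (1 + √δ) / 2) * (p - 1) ≤ 0 :=
      mul_nonpos_of_nonpos_of_nonneg (by linarith) (by linarith)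
    unfold gammaF
    linarith
  · push Not at h2
    have hd := dStar_mem hn
    have hn1 : 1 < n := by
      rcases hn.lt_or_eq with h | rfl
      · exact h
      · have : dStar 1 = 0 := by
          have := dStar_sq (le_refl (1 : ℝ))
          nlinarith
        linarith
    refine gammaF_pos hp ?_
    rcases h'.lt_or_eq with h3 | h3
    · rwa [pDelta_eq_pF hn1 h3 h2] at h
    · rw [pDelta_eq_pS hn1 h3.ge, pS_eq hn1, h3] at h
      rwa [pF, if_pos (by linarith)]

/-! ### Moment inequalities -/

lemma monotoneOn_of_hasDerivAt_nonneg {f f' : ℝ → ℝ} {a b : ℝ} (hc : ContinuousOn f (Icc a b))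
    (hd : ∀ t ∈ Ioo a b, HasDerivAt f (f' t) t) (h0 : ∀ t ∈ Ioo a b, 0 ≤ f' t) :
    MonotoneOn f (Icc a b) := by
  refine monotoneOn_of_deriv_nonneg (convex_Icc a b) hc ?_ ?_
  · rw [interior_Icc]
    exact fun t ht => (hd t ht).differentiableAt.differentiableWithinAt
  · rw [interior_Icc]
    intro t ht
    rw [(hd t ht).deriv]
    exact h0 t ht

lemma hasDerivAt_primitive {g : ℝ → ℝ} {b t : ℝ} (hg : ContinuousOn g (Icc 0 b))
    (ht : t ∈ Ioo 0 b) : HasDerivAt (fun t => ∫ s in (0 : ℝ)..t, g s) (g t) t := by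
  refine intervalIntegral.integral_hasDerivAt_right ?_ ?_ ?_
  · refine ContinuousOn.intervalIntegrable (hg.mono ?_)
    rw [uIcc_of_le ht.1.le]
    exact Icc_subset_Icc_right ht.2.le
  · exact (hg.mono Ioo_subset_Icc_self).stronglyMeasurableAtFilter isOpen_Ioo t ht
  · exact hg.continuousAt (Icc_mem_nhds ht.1 ht.2)

lemma continuousOn_primitive {g : ℝ → ℝ} {b : ℝ} (hg : ContinuousOn g (Icc 0 b)) :
    ContinuousOn (fun t => ∫ s in (0 : ℝ)..t, g s) (Icc 0 b) := by
  rcases le_or_gt 0 b with hb | hb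
  · have := intervalIntegral.continuousOn_primitive_interval (f := g) (a := 0) (b := b)
      (μ := volume) (by rw [uIcc_of_le hb]; exact hg.integrableOn_Icc)
    rwa [uIcc_of_le hb] at this
  · simp [Icc_eq_empty hb.not_ge]

lemma integral_nonneg_of_Ioo {g : ℝ → ℝ} {t : ℝ} (ht : 0 ≤ t) (hg : ∀ s ∈ Ioc 0 t, 0 ≤ g s) :
    0 ≤ ∫ s in (0 : ℝ)..t, g s := by
  rw [intervalIntegral.integral_of_le ht]
  exact setIntegral_nonneg measurableSet_Ioc hg

/-- The multiplier `exp (ν₁ (1+t)^{1-β} / (1-β))`, which absorbs the damping term. -/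
def damp (ν₁ β t : ℝ) : ℝ := Real.exp (ν₁ * ((1 + t) ^ (1 - β) / (1 - β)))

lemma damp_pos (ν₁ β t : ℝ) : 0 < damp ν₁ β t := Real.exp_pos _

lemma damp_zero (ν₁ β : ℝ) : damp ν₁ β 0 = Real.exp (ν₁ / (1 - β)) := by
  simp [damp, div_eq_mul_inv]

lemma damp_le_one {ν₁ β t : ℝ} (hν₁ : 0 ≤ ν₁) (hβ : 1 < β) (ht : 0 ≤ t) : damp ν₁ β t ≤ 1 := by
  refine Real.exp_le_one_iff.2 (mul_nonpos_of_nonneg_of_nonpos hν₁ ?_)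
  exact div_nonpos_of_nonneg_of_nonpos (by positivity) (by linarith)

lemma hasDerivAt_damp {ν₁ β t : ℝ} (hβ : 1 < β) (ht : 0 ≤ t) :
    HasDerivAt (damp ν₁ β) (damp ν₁ β t * (ν₁ / (1 + t) ^ β)) t := by
  have h1 : HasDerivAt (fun s : ℝ => 1 + s) 1 t := (hasDerivAt_id t).const_add 1
  have h2 := ((h1.rpow_const (p := 1 - β) (Or.inl (by positivity))).div_const (1 - β)).const_mul ν₁
  have h3 := h2.exp
  have : 1 - β ≠ 0 := by linarith
  have h4 : (1 : ℝ) - β - 1 = -β := by ring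
  refine h3.congr_deriv ?_
  unfold damp
  rw [h4, Real.rpow_neg (by positivity)]
  field_simp

lemma continuousOn_damp {ν₁ β b : ℝ} (hβ : 1 < β) : ContinuousOn (damp ν₁ β) (Icc 0 b) :=
  fun _ ht => (hasDerivAt_damp hβ ht.1).continuousAt.continuousWithinAt

/-- Together with `damp_le_one` this confines the multiplier to a fixed interval. Its lower end is
the factor e^{ν₁/(1−β)} in δ. -/
lemma damp_zero_le {ν₁ β t : ℝ} (hν₁ : 0 ≤ ν₁) (hβ : 1 < β) (ht : 0 ≤ t) :
    damp ν₁ β 0 ≤ damp ν₁ β t := by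
  refine monotoneOn_of_hasDerivAt_nonneg (continuousOn_damp hβ)
    (fun s hs => hasDerivAt_damp hβ hs.1.le) (fun s hs => ?_)
    (left_mem_Icc.2 ht) (right_mem_Icc.2 ht) ht
  have := damp_pos ν₁ β s
  have : 0 < 1 + s := by linarith [hs.1]
  positivity

/-- `G` is a spatial moment of a solution, `H` its time derivative and `N` the moment of the
nonlinear term: `G'' + ν₁ (1+t)^{-β} G' = (κ² + a (1+t)^{-2}) G + N` in integrated form. -/
structure IsMoment (ν₁ β a κ t₁ : ℝ) (G H N : ℝ → ℝ) : Prop where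
  contG : ContinuousOn G (Icc 0 t₁)
  contH : ContinuousOn H (Icc 0 t₁)
  deriv : ∀ t ∈ Ioo 0 t₁, HasDerivAt G (H t) t
  nonneg : ∀ t ∈ Ioc 0 t₁, 0 ≤ N t
  integrable : IntervalIntegrable N volume 0 t₁
  eq : ∀ t ∈ Icc 0 t₁, H t + ∫ s in (0 : ℝ)..t, ν₁ / (1 + s) ^ β * H s
    = H 0 + (∫ s in (0 : ℝ)..t, (κ ^ 2 + a / (1 + s) ^ 2) * G s) + ∫ s in (0 : ℝ)..t, N s

lemma continuousOn_potential {a κ b : ℝ} :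
    ContinuousOn (fun s => κ ^ 2 + a / (1 + s) ^ 2) (Icc 0 b) := by
  intro s hs
  have : (1 + s) ^ 2 ≠ 0 := by have := hs.1; positivity
  have h2 : ContinuousAt (fun s => κ ^ 2 + a / (1 + s) ^ 2) s := by fun_prop (disch := assumption)
  exact h2.continuousWithinAt

lemma continuousOn_friction {ν₁ β b : ℝ} :
    ContinuousOn (fun s => ν₁ / (1 + s) ^ β) (Icc 0 b) := by
  intro s hs
  have h0 : 0 < 1 + s := by linarith [hs.1]
  have h1 : (1 + s) ^ β ≠ 0 := (Real.rpow_pos_of_pos h0 β).ne'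
  have h2 : ContinuousAt (fun s : ℝ => (1 + s) ^ β) s :=
    (continuousAt_const.add continuousAt_id).rpow_const (Or.inl h0.ne')
  exact (continuousAt_const.div h2 h1).continuousWithinAt

lemma potential_nonneg {a κ s : ℝ} (ha : 0 ≤ a) : 0 ≤ κ ^ 2 + a / (1 + s) ^ 2 := by positivity

/-- The part of the lower bound for `damp · H` that does not involve the nonlinearity. -/
def linearPart (ν₁ β a κ : ℝ) (G H : ℝ → ℝ) (t : ℝ) : ℝ :=
  damp ν₁ β 0 * H 0 + ∫ s in (0 : ℝ)..t, damp ν₁ β s * (κ ^ 2 + a / (1 + s) ^ 2) * G s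

namespace IsMoment

variable {ν₁ β a κ t₁ : ℝ} {G H N : ℝ → ℝ}

lemma continuousOn_source (h : IsMoment ν₁ β a κ t₁ G H N) (hβ : 1 < β) :
    ContinuousOn (fun s => damp ν₁ β s * (κ ^ 2 + a / (1 + s) ^ 2) * G s) (Icc 0 t₁) :=
  ((continuousOn_damp hβ).mul continuousOn_potential).mul h.contG

lemma continuousOn_linearPart (h : IsMoment ν₁ β a κ t₁ G H N) (hβ : 1 < β) :
    ContinuousOn (linearPart ν₁ β a κ G H) (Icc 0 t₁) :=
  continuousOn_const.add (continuousOn_primitive (h.continuousOn_source hβ))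

lemma hasDerivAt_linearPart (h : IsMoment ν₁ β a κ t₁ G H N) (hβ : 1 < β) {t : ℝ}
    (ht : t ∈ Ioo 0 t₁) : HasDerivAt (linearPart ν₁ β a κ G H)
      (damp ν₁ β t * (κ ^ 2 + a / (1 + t) ^ 2) * G t) t :=
  (hasDerivAt_primitive (h.continuousOn_source hβ) ht).const_add _

lemma linearPart_zero : linearPart ν₁ β a κ G H 0 = damp ν₁ β 0 * H 0 := by simp [linearPart]

lemma integrable_sub (h : IsMoment ν₁ β a κ t₁ G H N) {s t : ℝ} (hs : 0 ≤ s) (hst : s ≤ t)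
    (ht : t ≤ t₁) : IntervalIntegrable N volume s t := by
  refine h.integrable.mono_set ?_
  rw [uIcc_of_le hst, uIcc_of_le (hs.trans (hst.trans ht))]
  exact Icc_subset_Icc hs ht

lemma integral_mono (h : IsMoment ν₁ β a κ t₁ G H N) {s t : ℝ} (hs : 0 ≤ s) (hst : s ≤ t)
    (ht : t ≤ t₁) : ∫ r in (0 : ℝ)..s, N r ≤ ∫ r in (0 : ℝ)..t, N r := by
  rw [← intervalIntegral.integral_add_adjacent_intervals
    (h.integrable_sub le_rfl hs (hst.trans ht)) (h.integrable_sub hs hst ht)]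
  have : 0 ≤ ∫ r in s..t, N r := by
    rw [intervalIntegral.integral_of_le hst]
    exact setIntegral_nonneg measurableSet_Ioc
      fun r hr => h.nonneg r ⟨hs.trans_lt hr.1, hr.2.trans ht⟩
  linarith

/-- Formally one integrates (damp · H)' = damp · (potential · G + N) and bounds damp below by its
initial value in the last term. Since N is merely integrable, its primitive P is not differentiated:
H − P is a C¹ combination of integrals, and P is frozen at the final time t. The derivative of the
resulting function is damp' · (P t − P s) ≥ 0. -/
lemma linearPart_add_le (h : IsMoment ν₁ β a κ t₁ G H N) (hν₁ : 0 ≤ ν₁) (hβ : 1 < β) {t : ℝ}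
    (ht : t ∈ Icc 0 t₁) : linearPart ν₁ β a κ G H t + damp ν₁ β 0 * ∫ s in (0 : ℝ)..t, N s
      ≤ damp ν₁ β t * H t := by
  set P : ℝ → ℝ := fun t => ∫ s in (0 : ℝ)..t, N s with hP
  have hsub : Icc 0 t ⊆ Icc 0 t₁ := Icc_subset_Icc_right ht.2
  have hc1 : ContinuousOn (fun s => (κ ^ 2 + a / (1 + s) ^ 2) * G s) (Icc 0 t₁) :=
    continuousOn_potential.mul h.contG
  have hc2 : ContinuousOn (fun s => ν₁ / (1 + s) ^ β * H s) (Icc 0 t₁) :=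
    continuousOn_friction.mul h.contH
  set K : ℝ → ℝ := fun s => H 0 + (∫ r in (0 : ℝ)..s, (κ ^ 2 + a / (1 + r) ^ 2) * G r)
    - ∫ r in (0 : ℝ)..s, ν₁ / (1 + r) ^ β * H r with hK
  have hKeq : ∀ s ∈ Icc 0 t₁, K s = H s - P s := fun s hs => by
    have := h.eq s hs
    simp only [hK, hP]
    linarith
  have hmono := monotoneOn_of_hasDerivAt_nonneg (a := 0) (b := t)
    (f := fun s => damp ν₁ β s * K s - linearPart ν₁ β a κ G H s + damp ν₁ β s * P t)
    (f' := fun s => damp ν₁ β s * (ν₁ / (1 + s) ^ β) * (P t - P s)) ?_ ?_ ?_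
    (left_mem_Icc.2 ht.1) (right_mem_Icc.2 ht.1) ht.1
  · simp only [hKeq t ht, hKeq 0 ⟨le_rfl, ht.1.trans ht.2⟩, linearPart_zero] at hmono
    have hP0 : P 0 = 0 := by simp [hP]
    rw [hP0] at hmono
    linarith
  · refine (((continuousOn_damp hβ).mul ?_).sub ((h.continuousOn_linearPart hβ).mono hsub)).add
      ((continuousOn_damp hβ).mul continuousOn_const)
    exact ((continuousOn_const.add (continuousOn_primitive hc1)).sub
      (continuousOn_primitive hc2)).mono hsub
  · intro s hs
    have hs' : s ∈ Ioo 0 t₁ := ⟨hs.1, hs.2.trans_le ht.2⟩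
    have hd := hasDerivAt_damp (ν₁ := ν₁) hβ hs.1.le
    have hdK : HasDerivAt K ((κ ^ 2 + a / (1 + s) ^ 2) * G s - ν₁ / (1 + s) ^ β * H s) s :=
      ((hasDerivAt_primitive hc1 hs').const_add _).sub (hasDerivAt_primitive hc2 hs')
    have := ((hd.mul hdK).sub (h.hasDerivAt_linearPart hβ hs')).add (hd.mul_const (P t))
    refine this.congr_deriv ?_
    rw [hKeq s (Ioo_subset_Icc_self hs')]
    ring
  · intro s hs
    have h1 := h.integral_mono hs.1.le hs.2.le ht.2
    have h2 := damp_pos ν₁ β s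
    have h3 : 0 < 1 + s := by linarith [hs.1]
    have h4 : 0 ≤ P t - P s := sub_nonneg.2 h1
    positivity

lemma linearPart_le (h : IsMoment ν₁ β a κ t₁ G H N) (hν₁ : 0 ≤ ν₁) (hβ : 1 < β) {t : ℝ}
    (ht : t ∈ Icc 0 t₁) : linearPart ν₁ β a κ G H t ≤ damp ν₁ β t * H t := by
  have h1 := h.linearPart_add_le hν₁ hβ ht
  have h2 : 0 ≤ ∫ s in (0 : ℝ)..t, N s :=
    integral_nonneg_of_Ioo ht.1 fun s hs => h.nonneg s ⟨hs.1, hs.2.trans ht.2⟩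
  have := mul_nonneg (damp_pos ν₁ β 0).le h2
  linarith

/-- Exponentially weighted supremum argument. Let μ be the maximum of e^{-Ls}(−G). If G is negative
somewhere, then μ > 0; two integrations of −G ≤ μ e^{Ls} improve the bound by the factor Q/(m₀L²) <
1, which is impossible at the point r where the maximum is attained. -/
lemma nonneg_G (h : IsMoment ν₁ β a κ t₁ G H N) (hν₁ : 0 ≤ ν₁) (hβ : 1 < β) (ha : 0 ≤ a)
    (hG0 : 0 ≤ G 0) (hH0 : 0 ≤ H 0) {t : ℝ} (ht : t ∈ Icc 0 t₁) : 0 ≤ G t := by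
  have ht₁ : 0 ≤ t₁ := ht.1.trans ht.2
  set Q := κ ^ 2 + a with hQ
  have hQ0 : 0 ≤ Q := by positivity
  set m₀ := damp ν₁ β 0
  have hm₀ : 0 < m₀ := damp_pos ν₁ β 0
  obtain ⟨L, hL0, hL⟩ : ∃ L : ℝ, 0 < L ∧ Q < m₀ * L ^ 2 := by
    refine ⟨Q / m₀ + 1, by positivity, ?_⟩
    have : m₀ * (Q / m₀ + 1) ^ 2 = Q + (m₀ * (Q / m₀) ^ 2 + Q + m₀) := by field_simp; ring
    rw [this]
    have : 0 < m₀ * (Q / m₀) ^ 2 + Q + m₀ := by positivity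
    linarith
  have hcont : ContinuousOn (fun s => Real.exp (-(L * s)) * -G s) (Icc 0 t₁) :=
    (by fun_prop : Continuous fun s : ℝ => Real.exp (-(L * s))).continuousOn.mul h.contG.neg
  obtain ⟨r, hr, hmax⟩ := isCompact_Icc.exists_isMaxOn ⟨0, left_mem_Icc.2 ht₁⟩ hcont
  set μ := Real.exp (-(L * r)) * -G r with hμ
  have hbound : ∀ s ∈ Icc 0 t₁, -G s ≤ μ * Real.exp (L * s) := by
    intro s hs
    have h1 : Real.exp (-(L * s)) * -G s ≤ μ := hmax hs
    have h2 := mul_le_mul_of_nonneg_right h1 (Real.exp_pos (L * s)).le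
    rwa [mul_right_comm, ← Real.exp_add, neg_add_cancel, Real.exp_zero, one_mul] at h2
  by_contra! hneg
  have hμ0 : 0 < μ := by
    have := hbound t ht
    have h2 : 0 < μ * Real.exp (L * t) := by linarith
    exact (mul_pos_iff_of_pos_right (Real.exp_pos _)).1 h2
  have hexp : ∀ s : ℝ, HasDerivAt (fun s => Real.exp (L * s)) (L * Real.exp (L * s)) s := by
    intro s
    have := ((hasDerivAt_id s).const_mul L).exp
    simpa [mul_comm] using this
  -- First integration: the source is at least −Q μ e^{Ls}, since damp times the potential is at
  -- most Q.
  have hA : ∀ s ∈ Icc 0 t₁, 0 ≤ linearPart ν₁ β a κ G H s + Q * μ / L * Real.exp (L * s) := by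
    intro s hs
    have := monotoneOn_of_hasDerivAt_nonneg (a := 0) (b := t₁)
      (f := fun s => linearPart ν₁ β a κ G H s + Q * μ / L * Real.exp (L * s))
      (f' := fun s => damp ν₁ β s * (κ ^ 2 + a / (1 + s) ^ 2) * G s
        + Q * μ / L * (L * Real.exp (L * s)))
      ((h.continuousOn_linearPart hβ).add (by fun_prop))
      (fun s hs => (h.hasDerivAt_linearPart hβ hs).add ((hexp s).const_mul _)) ?_
      (left_mem_Icc.2 ht₁) hs hs.1
    · refine le_trans ?_ this
      simp only [linearPart_zero]
      positivity
    · intro s hs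
      have h1 := hbound s (Ioo_subset_Icc_self hs)
      have h2 : damp ν₁ β s * (κ ^ 2 + a / (1 + s) ^ 2) ≤ 1 * Q := by
        refine mul_le_mul (damp_le_one hν₁ hβ hs.1.le) ?_ (potential_nonneg ha) zero_le_one
        have : a / (1 + s) ^ 2 ≤ a := div_le_self ha (one_le_pow₀ (by linarith [hs.1]))
        linarith
      have h3 : 0 ≤ damp ν₁ β s * (κ ^ 2 + a / (1 + s) ^ 2) :=
        mul_nonneg (damp_pos _ _ _).le (potential_nonneg ha)
      have h4 : Q * μ / L * (L * Real.exp (L * s)) = Q * (μ * Real.exp (L * s)) := by field_simp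
      have h5 : 0 < μ * Real.exp (L * s) := by positivity
      rw [h4]
      nlinarith [mul_le_mul_of_nonneg_left h1 h3, mul_le_mul_of_nonneg_right h2 h5.le]
  -- Second integration, where dividing by damp costs at most 1/m₀.
  have hGr := monotoneOn_of_hasDerivAt_nonneg (a := 0) (b := t₁)
      (f := fun s => G s + Q * μ / (m₀ * L ^ 2) * Real.exp (L * s))
      (f' := fun s => H s + Q * μ / (m₀ * L ^ 2) * (L * Real.exp (L * s)))
      (h.contG.add (by fun_prop))
      (fun s hs => (h.deriv s hs).add ((hexp s).const_mul _)) ?_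
      (left_mem_Icc.2 ht₁) hr hr.1
  · simp only at hGr
    have h1 : G r = -(μ * Real.exp (L * r)) := by
      rw [hμ, mul_right_comm, ← Real.exp_add, neg_add_cancel, Real.exp_zero, one_mul, neg_neg]
    have h2 : 0 ≤ G 0 + Q * μ / (m₀ * L ^ 2) * Real.exp (L * 0) := by positivity
    have h3 : 0 ≤ (Q / (m₀ * L ^ 2) - 1) * (μ * Real.exp (L * r)) := by
      have : (Q / (m₀ * L ^ 2) - 1) * (μ * Real.exp (L * r))
        = G r + Q * μ / (m₀ * L ^ 2) * Real.exp (L * r) := by rw [h1]; ring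
      rw [this]
      exact h2.trans hGr
    have h4 : Q / (m₀ * L ^ 2) < 1 := (div_lt_one (by positivity)).2 hL
    have h5 : 0 < μ * Real.exp (L * r) := by positivity
    nlinarith
  · intro s hs
    have hs' := Ioo_subset_Icc_self hs
    have h1 := hA s hs'
    have h2 := h.linearPart_le hν₁ hβ hs'
    have h3 : m₀ ≤ damp ν₁ β s := damp_zero_le hν₁ hβ hs'.1
    set X := Q * μ / L * Real.exp (L * s) with hX
    have hX0 : 0 ≤ X := by positivity
    have h4 : Q * μ / (m₀ * L ^ 2) * (L * Real.exp (L * s)) = X / m₀ := by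
      rw [hX]; field_simp
    rw [h4]
    have h5 : 0 ≤ damp ν₁ β s * (H s + X / m₀) := by
      have : X ≤ damp ν₁ β s * (X / m₀) := by
        rw [← mul_div_assoc, le_div_iff₀ hm₀, mul_comm]
        exact mul_le_mul_of_nonneg_right h3 hX0
      nlinarith
    exact (mul_nonneg_iff_of_pos_left (damp_pos _ _ _)).1 h5

lemma linearPart_nonneg (h : IsMoment ν₁ β a κ t₁ G H N) (hν₁ : 0 ≤ ν₁) (hβ : 1 < β) (ha : 0 ≤ a)
    (hG0 : 0 ≤ G 0) (hH0 : 0 ≤ H 0) {t : ℝ} (ht : t ∈ Icc 0 t₁) :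
    0 ≤ linearPart ν₁ β a κ G H t := by
  refine add_nonneg (mul_nonneg (damp_pos _ _ _).le hH0) (integral_nonneg_of_Ioo ht.1 ?_)
  intro s hs
  exact mul_nonneg (mul_nonneg (damp_pos _ _ _).le (potential_nonneg ha))
    (h.nonneg_G hν₁ hβ ha hG0 hH0 ⟨hs.1.le, hs.2.trans ht.2⟩)

lemma nonneg_H (h : IsMoment ν₁ β a κ t₁ G H N) (hν₁ : 0 ≤ ν₁) (hβ : 1 < β) (ha : 0 ≤ a)
    (hG0 : 0 ≤ G 0) (hH0 : 0 ≤ H 0) {t : ℝ} (ht : t ∈ Icc 0 t₁) : 0 ≤ H t :=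
  (mul_nonneg_iff_of_pos_left (damp_pos _ _ _)).1
    ((h.linearPart_nonneg hν₁ hβ ha hG0 hH0 ht).trans (h.linearPart_le hν₁ hβ ht))

lemma damp_mul_le (h : IsMoment ν₁ β a κ t₁ G H N) (hν₁ : 0 ≤ ν₁) (hβ : 1 < β) (ha : 0 ≤ a)
    (hG0 : 0 ≤ G 0) (hH0 : 0 ≤ H 0) {t : ℝ} (ht : t ∈ Icc 0 t₁) : damp ν₁ β t * H t ≤ H t :=
  mul_le_of_le_one_left (h.nonneg_H hν₁ hβ ha hG0 hH0 ht) (damp_le_one hν₁ hβ ht.1)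

lemma monotoneOn_G (h : IsMoment ν₁ β a κ t₁ G H N) (hν₁ : 0 ≤ ν₁) (hβ : 1 < β) (ha : 0 ≤ a)
    (hG0 : 0 ≤ G 0) (hH0 : 0 ≤ H 0) : MonotoneOn G (Icc 0 t₁) :=
  monotoneOn_of_hasDerivAt_nonneg h.contG h.deriv
    fun _ ht => h.nonneg_H hν₁ hβ ha hG0 hH0 (Ioo_subset_Icc_self ht)

/-- A lower bound for the nonlinear term on a time interval makes the moment grow there. -/
lemma add_le_of_le (h : IsMoment ν₁ β a κ t₁ G H N) (hν₁ : 0 ≤ ν₁) (hβ : 1 < β) (ha : 0 ≤ a)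
    (hG0 : 0 ≤ G 0) (hH0 : 0 ≤ H 0) {t r l : ℝ} (ht : 0 ≤ t) (hr : 0 ≤ r) (htr : t + r ≤ t₁)
    (hl : ∀ s ∈ Ioo t (t + r), l ≤ N s) :
    G t + damp ν₁ β 0 * l * r ^ 2 / 4 ≤ G (t + r) := by
  have hmid : t + r / 2 ≤ t + r := by linarith
  -- The first half of the interval makes the velocity large; the second half integrates that
  -- velocity.
  have hH : ∀ s ∈ Icc (t + r / 2) (t + r), damp ν₁ β 0 * (l * (r / 2)) ≤ H s := by
    intro s hs
    have hs' : s ∈ Icc 0 t₁ := ⟨by linarith [hs.1], hs.2.trans htr⟩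
    have h1 := h.linearPart_add_le hν₁ hβ hs'
    have h2 := h.linearPart_nonneg hν₁ hβ ha hG0 hH0 hs'
    have h3 := h.damp_mul_le hν₁ hβ ha hG0 hH0 hs'
    have h4 : l * (r / 2) ≤ ∫ x in (0 : ℝ)..s, N x := by
      have htm : t ≤ t + r / 2 := by linarith
      have h5 := h.integral_mono (s := t + r / 2) (t := s) (by linarith) hs.1 hs'.2
      have hi1 := h.integrable_sub le_rfl ht (by linarith : t ≤ t₁)
      have hi2 := h.integrable_sub ht htm (by linarith)
      rw [← intervalIntegral.integral_add_adjacent_intervals hi1 hi2] at h5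
      have h6 : 0 ≤ ∫ x in (0 : ℝ)..t, N x :=
        integral_nonneg_of_Ioo ht fun x hx => h.nonneg x ⟨hx.1, by linarith [hx.2]⟩
      have h7 : ∫ _ in t..(t + r / 2), l ≤ ∫ x in t..(t + r / 2), N x := by
        refine intervalIntegral.integral_mono_on_of_le_Ioo htm (by simp) hi2 fun x hx => ?_
        exact hl x ⟨hx.1, by linarith [hx.2]⟩
      rw [intervalIntegral.integral_const, smul_eq_mul] at h7
      linarith
    have := mul_le_mul_of_nonneg_left h4 (damp_pos ν₁ β 0).le
    linarith
  have hsub : Icc (t + r / 2) (t + r) ⊆ Icc 0 t₁ := Icc_subset_Icc (by linarith) htr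
  have h1 := monotoneOn_of_hasDerivAt_nonneg (a := t + r / 2) (b := t + r)
    (f := fun s => G s - damp ν₁ β 0 * (l * (r / 2)) * s)
    (f' := fun s => H s - damp ν₁ β 0 * (l * (r / 2)) * 1)
    ((h.contG.mono hsub).sub (by fun_prop))
    (fun s hs => (h.deriv s ⟨by linarith [hs.1], hs.2.trans_le htr⟩).sub
      ((hasDerivAt_id s).const_mul _))
    (fun s hs => by linarith [hH s (Ioo_subset_Icc_self hs)])
    (left_mem_Icc.2 hmid) (right_mem_Icc.2 hmid) hmid
  have h2 : G t ≤ G (t + r / 2) := (h.monotoneOn_G hν₁ hβ ha hG0 hH0)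
    ⟨ht, by linarith⟩ ⟨by linarith, by linarith⟩ (by linarith)
  simp only at h1
  nlinarith

/-- Growth of the total mass caused by the negative mass term. -/
lemma rpow_le_of_mass {k : ℝ} (h : IsMoment ν₁ β a 0 t₁ G H N) (hν₁ : 0 ≤ ν₁) (hβ : 1 < β)
    (ha : 0 ≤ a) (hG0 : 0 ≤ G 0) (hH0 : 0 ≤ H 0) (hk : 1 < k)
    (hak : damp ν₁ β 0 * a = k * (k - 1)) {t : ℝ} (ht : t ∈ Icc 1 t₁) :
    (damp ν₁ β 0 * H 0 + (k - 1) * G 0) / (2 * (2 * k - 1)) * (1 + t) ^ k ≤ G t := by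
  set Y₀ := damp ν₁ β 0 * H 0 + (k - 1) * G 0 with hY₀
  have hk1 : 0 < k - 1 := by linarith
  have hY₀0 : 0 ≤ Y₀ := by have := damp_pos ν₁ β 0; positivity
  have ht₁ : (0 : ℝ) ≤ t₁ := by linarith [ht.1, ht.2]
  have ht0 : t ∈ Icc 0 t₁ := ⟨by linarith [ht.1], ht.2⟩
  have hone : ∀ s : ℝ, HasDerivAt (fun s : ℝ => 1 + s) 1 s := fun s => (hasDerivAt_id s).const_add 1
  have hrpow : ∀ (e s : ℝ), 0 ≤ s →
      HasDerivAt (fun s : ℝ => (1 + s) ^ e) (e * (1 + s) ^ (e - 1)) s := by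
    intro e s hs
    simpa using (hone s).rpow_const (p := e) (Or.inl (by positivity))
  have hcpow : ∀ e : ℝ, ContinuousOn (fun s : ℝ => (1 + s) ^ e) (Icc 0 t₁) :=
    fun e s hs => (hrpow e s hs.1).continuousAt.continuousWithinAt
  set A := linearPart ν₁ β a 0 G H with hA
  -- Factor the Euler operator as ((1+s)∂ − k)((1+s)∂ + (k−1)). The first factor is integrated here,
  -- with A, a lower bound for damp · H and hence for H, in place of G'. Both error terms, (damp −
  -- m₀) a G and (k−1)(1+s)(H − A), have the right sign.
  have hY : ∀ s ∈ Icc 0 t₁, Y₀ * (1 + s) ^ k ≤ (1 + s) * A s + (k - 1) * G s := by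
    intro s hs
    have := monotoneOn_of_hasDerivAt_nonneg (a := 0) (b := t₁)
      (f := fun s => (1 + s) ^ (-k) * ((1 + s) * A s + (k - 1) * G s))
      (f' := fun s => -k * (1 + s) ^ (-k - 1) * ((1 + s) * A s + (k - 1) * G s)
        + (1 + s) ^ (-k) * ((1 * A s + (1 + s) * (damp ν₁ β s * (0 ^ 2 + a / (1 + s) ^ 2) * G s))
          + (k - 1) * H s))
      ((hcpow _).mul (((by fun_prop : Continuous fun s : ℝ => 1 + s).continuousOn.mul
        (h.continuousOn_linearPart hβ)).add (continuousOn_const.mul h.contG)))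
      (fun s hs => (hrpow _ s hs.1.le).mul (((hone s).mul (h.hasDerivAt_linearPart hβ hs)).add
        ((h.deriv s hs).const_mul _))) ?_
      (left_mem_Icc.2 ht₁) hs hs.1
    · have h1 : (0 : ℝ) < 1 + s := by linarith [hs.1]
      have h2 : (1 : ℝ) + 0 = 1 := by norm_num
      simp only [h2, Real.one_rpow, one_mul, hA, linearPart_zero] at this
      have h3 := mul_le_mul_of_nonneg_left this (Real.rpow_pos_of_pos h1 k).le
      rw [← mul_assoc, ← Real.rpow_add h1, add_neg_cancel, Real.rpow_zero, one_mul] at h3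
      rw [mul_comm]
      exact h3
    · intro s hs
      have hs' := Ioo_subset_Icc_self hs
      have h1 : (0 : ℝ) < 1 + s := by linarith [hs.1]
      have h2 : (1 + s) ^ (-k) = (1 + s) ^ (-k - 1) * (1 + s) := by
        rw [← Real.rpow_add_one h1.ne']; ring_nf
      rw [h2]
      have h3 := h.nonneg_G hν₁ hβ ha hG0 hH0 hs'
      have h4 := h.linearPart_le hν₁ hβ hs'
      have h5 := h.damp_mul_le hν₁ hβ ha hG0 hH0 hs'
      have h6 := damp_zero_le hν₁ hβ hs.1.le
      have h7 : 0 ≤ (k - 1) * (H s - A s) := mul_nonneg hk1.le (by simp only [hA]; linarith)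
      have h8 : 0 ≤ (damp ν₁ β s - damp ν₁ β 0) * (a * G s) :=
        mul_nonneg (by linarith) (by positivity)
      have h9 : (0 : ℝ) < (1 + s) ^ (-k - 1) := Real.rpow_pos_of_pos h1 _
      have : -k * (1 + s) ^ (-k - 1) * ((1 + s) * A s + (k - 1) * G s)
          + (1 + s) ^ (-k - 1) * (1 + s) *
            ((1 * A s + (1 + s) * (damp ν₁ β s * (0 ^ 2 + a / (1 + s) ^ 2) * G s)) + (k - 1) * H s)
          = (1 + s) ^ (-k - 1) * ((damp ν₁ β s - damp ν₁ β 0) * (a * G s)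
            + (1 + s) * ((k - 1) * (H s - A s))) := by
        field_simp
        linear_combination (G s) * hak
      rw [this]
      positivity
  have h2k : 1 < 2 * k - 1 := by linarith
  -- The second factor, with integrating factor (1+s)^{k−1}.
  have hG := monotoneOn_of_hasDerivAt_nonneg (a := 0) (b := t₁)
      (f := fun s => (1 + s) ^ (k - 1) * G s - Y₀ / (2 * k - 1) * (1 + s) ^ (2 * k - 1))
      (f' := fun s => ((k - 1) * (1 + s) ^ (k - 1 - 1) * G s + (1 + s) ^ (k - 1) * H s)
        - Y₀ / (2 * k - 1) * ((2 * k - 1) * (1 + s) ^ (2 * k - 1 - 1)))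
      (((hcpow _).mul h.contG).sub (continuousOn_const.mul (hcpow _)))
      (fun s hs => ((hrpow _ s hs.1.le).mul (h.deriv s hs)).sub
        ((hrpow _ s hs.1.le).const_mul _)) ?_
      (left_mem_Icc.2 ht₁) ht0 ht0.1
  · have h1 : (0 : ℝ) < 1 + t := by linarith [ht0.1]
    have h2 : (1 : ℝ) + 0 = 1 := by norm_num
    simp only [h2, Real.one_rpow, one_mul] at hG
    -- For t ≥ 1 the contribution of the lower endpoint costs at most half of the main term.
    have h3 : (2 : ℝ) ≤ (1 + t) ^ (2 * k - 1) := by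
      calc (2 : ℝ) ≤ 1 + t := by linarith [ht.1]
        _ = (1 + t) ^ (1 : ℝ) := (Real.rpow_one _).symm
        _ ≤ _ := Real.rpow_le_rpow_of_exponent_le (by linarith only [ht.1]) h2k.le
    have h4 : Y₀ / (2 * (2 * k - 1)) * (1 + t) ^ (2 * k - 1) ≤ (1 + t) ^ (k - 1) * G t := by
      have h5 : Y₀ / (2 * (2 * k - 1)) = Y₀ / (2 * k - 1) / 2 := by field_simp
      have h6 : 0 ≤ Y₀ / (2 * k - 1) := by positivity
      rw [h5]
      nlinarith
    have h7 : (1 + t) ^ (2 * k - 1) = (1 + t) ^ (k - 1) * (1 + t) ^ k := by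
      rw [← Real.rpow_add h1]; ring_nf
    rw [h7] at h4
    refine le_of_mul_le_mul_left ?_ (Real.rpow_pos_of_pos h1 (k - 1))
    linarith
  · intro s hs
    have hs' := Ioo_subset_Icc_self hs
    have h1 : (0 : ℝ) < 1 + s := by linarith [hs.1]
    have h2 := hY s hs'
    have h4 := h.linearPart_le hν₁ hβ hs'
    have h5 := h.damp_mul_le hν₁ hβ ha hG0 hH0 hs'
    have h3 : (1 + s) ^ (k - 1) = (1 + s) ^ (k - 1 - 1) * (1 + s) := by
      rw [← Real.rpow_add_one h1.ne']; ring_nf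
    have h6 : (1 + s) ^ (2 * k - 1 - 1) = (1 + s) ^ (k - 1 - 1) * (1 + s) ^ k := by
      rw [← Real.rpow_add h1]; ring_nf
    have h7 : (0 : ℝ) < (1 + s) ^ (k - 1 - 1) := Real.rpow_pos_of_pos h1 _
    have h8 : 0 ≤ (1 + s) * (H s - A s) := mul_nonneg h1.le (by simp only [hA]; linarith)
    have : ((k - 1) * (1 + s) ^ (k - 1 - 1) * G s + (1 + s) ^ (k - 1) * H s)
        - Y₀ / (2 * k - 1) * ((2 * k - 1) * (1 + s) ^ (2 * k - 1 - 1))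
        = (1 + s) ^ (k - 1 - 1) * ((k - 1) * G s + (1 + s) * H s - Y₀ * (1 + s) ^ k) := by
      rw [h3, h6, ← mul_assoc (Y₀ / (2 * k - 1)), div_mul_cancel₀ _ (by linarith)]
      ring
    rw [this]
    exact mul_nonneg h7.le (by linarith)

/-- Exponential growth of the exponential moments. -/
lemma exp_le_of_wave (h : IsMoment ν₁ β a κ t₁ G H N) (hν₁ : 0 ≤ ν₁) (hβ : 1 < β)
    (ha : 0 ≤ a) (hG0 : 0 ≤ G 0) (hH0 : 0 ≤ H 0) (hκ : 1 ≤ κ) (hκ2 : κ ≤ 2) {t : ℝ}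
    (ht : t ∈ Icc 1 t₁) :
    damp ν₁ β 0 * (H 0 + G 0) / 8 * Real.exp (κ * t) ≤ G t := by
  set Z₀ := damp ν₁ β 0 * (H 0 + G 0) with hZ₀
  have hm₀ := damp_pos ν₁ β 0
  have hZ₀0 : 0 ≤ Z₀ := by positivity
  have hκ0 : 0 < κ := by linarith
  have ht₁ : (0 : ℝ) ≤ t₁ := by linarith [ht.1, ht.2]
  have ht0 : t ∈ Icc 0 t₁ := ⟨by linarith [ht.1], ht.2⟩
  have hexp : ∀ L s : ℝ, HasDerivAt (fun s => Real.exp (L * s)) (L * Real.exp (L * s)) s := by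
    intro L s
    have := ((hasDerivAt_id s).const_mul L).exp
    simpa [mul_comm] using this
  set A := linearPart ν₁ β a κ G H with hA
  -- Same scheme with the factorisation (∂ − κ)(∂ + κ). Keeping `damp` in front of G makes the κ²
  -- terms cancel exactly, and what remains is non-negative.
  have hZ : ∀ s ∈ Icc 0 t₁, Z₀ * Real.exp (κ * s) ≤ A s + κ * (damp ν₁ β s * G s) := by
    intro s hs
    have := monotoneOn_of_hasDerivAt_nonneg (a := 0) (b := t₁)
      (f := fun s => Real.exp (-κ * s) * (A s + κ * (damp ν₁ β s * G s)))
      (f' := fun s => (-κ * Real.exp (-κ * s)) * (A s + κ * (damp ν₁ β s * G s))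
        + Real.exp (-κ * s) * (damp ν₁ β s * (κ ^ 2 + a / (1 + s) ^ 2) * G s
          + κ * (damp ν₁ β s * (ν₁ / (1 + s) ^ β) * G s + damp ν₁ β s * H s)))
      ((by fun_prop : Continuous fun s : ℝ => Real.exp (-κ * s)).continuousOn.mul
        ((h.continuousOn_linearPart hβ).add
          (continuousOn_const.mul ((continuousOn_damp hβ).mul h.contG))))
      (fun s hs => (hexp _ s).mul ((h.hasDerivAt_linearPart hβ hs).add
        (((hasDerivAt_damp hβ hs.1.le).mul (h.deriv s hs)).const_mul κ))) ?_
      (left_mem_Icc.2 ht₁) hs hs.1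
    · simp only [mul_zero, Real.exp_zero, one_mul, hA, linearPart_zero] at this
      have h3 := mul_le_mul_of_nonneg_left this (Real.exp_pos (κ * s)).le
      rw [← mul_assoc (Real.exp (κ * s)) (Real.exp (-κ * s)), ← Real.exp_add] at h3
      have h4 : κ * s + -κ * s = 0 := by ring
      rw [h4, Real.exp_zero, one_mul] at h3
      refine le_trans ?_ h3
      rw [mul_comm]
      refine mul_le_mul_of_nonneg_left ?_ (Real.exp_pos _).le
      have : 0 ≤ (κ - 1) * (damp ν₁ β 0 * G 0) := mul_nonneg (by linarith) (by positivity)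
      rw [hZ₀]
      nlinarith
    · intro s hs
      have hs' := Ioo_subset_Icc_self hs
      have h1 : (0 : ℝ) < 1 + s := by linarith [hs.1]
      have h3 := h.nonneg_G hν₁ hβ ha hG0 hH0 hs'
      have h4 : 0 ≤ damp ν₁ β s * H s - A s := sub_nonneg.2 (h.linearPart_le hν₁ hβ hs')
      have h5 := damp_pos ν₁ β s
      have : (-κ * Real.exp (-κ * s)) * (A s + κ * (damp ν₁ β s * G s))
        + Real.exp (-κ * s) * (damp ν₁ β s * (κ ^ 2 + a / (1 + s) ^ 2) * G s
          + κ * (damp ν₁ β s * (ν₁ / (1 + s) ^ β) * G s + damp ν₁ β s * H s))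
        = Real.exp (-κ * s) * (κ * (damp ν₁ β s * H s - A s)
          + damp ν₁ β s * (a / (1 + s) ^ 2) * G s
          + κ * (damp ν₁ β s * (ν₁ / (1 + s) ^ β) * G s)) := by ring
      rw [this]
      positivity
  have hG := monotoneOn_of_hasDerivAt_nonneg (a := 0) (b := t₁)
      (f := fun s => Real.exp (κ * s) * G s - Z₀ / (2 * κ) * Real.exp (2 * κ * s))
      (f' := fun s => (κ * Real.exp (κ * s) * G s + Real.exp (κ * s) * H s)
        - Z₀ / (2 * κ) * (2 * κ * Real.exp (2 * κ * s)))
      (((by fun_prop : Continuous fun s : ℝ => Real.exp (κ * s)).continuousOn.mul h.contG).sub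
        (by fun_prop))
      (fun s hs => ((hexp _ s).mul (h.deriv s hs)).sub ((hexp _ s).const_mul _)) ?_
      (left_mem_Icc.2 ht₁) ht0 ht0.1
  · simp only [mul_zero, Real.exp_zero, one_mul, mul_one] at hG
    have h3 : (2 : ℝ) ≤ Real.exp (2 * κ * t) := by
      have h5 := Real.add_one_le_exp (2 * κ * t)
      have h6 : 1 ≤ κ * t := one_le_mul_of_one_le_of_one_le hκ ht.1
      linarith
    -- The bound κ ≤ 2 makes the constant uniform in the frequency.
    have h5 : Z₀ / 8 ≤ Z₀ / (2 * κ) / 2 := by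
      rw [div_div]
      exact div_le_div_of_nonneg_left hZ₀0 (by positivity) (by linarith)
    have h6 : 0 ≤ Z₀ / (2 * κ) := by positivity
    have h4 : Z₀ / 8 * Real.exp (2 * κ * t) ≤ Real.exp (κ * t) * G t := by
      nlinarith
    have h7 : Real.exp (2 * κ * t) = Real.exp (κ * t) * Real.exp (κ * t) := by
      rw [← Real.exp_add]; ring_nf
    rw [h7] at h4
    refine le_of_mul_le_mul_left ?_ (Real.exp_pos (κ * t))
    linarith
  · intro s hs
    have hs' := Ioo_subset_Icc_self hs
    have h2 := hZ s hs'
    have h3 := h.nonneg_G hν₁ hβ ha hG0 hH0 hs'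
    have h4 := h.linearPart_le hν₁ hβ hs'
    have h5 := h.damp_mul_le hν₁ hβ ha hG0 hH0 hs'
    have h6 := damp_le_one hν₁ hβ hs'.1
    have h7 : Real.exp (2 * κ * s) = Real.exp (κ * s) * Real.exp (κ * s) := by
      rw [← Real.exp_add]; ring_nf
    have : (κ * Real.exp (κ * s) * G s + Real.exp (κ * s) * H s)
        - Z₀ / (2 * κ) * (2 * κ * Real.exp (2 * κ * s))
        = Real.exp (κ * s) * (κ * G s + H s - Z₀ * Real.exp (κ * s)) := by
      rw [h7]
      field_simp
    rw [this]
    refine mul_nonneg (Real.exp_pos _).le ?_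
    have h8 : κ * (damp ν₁ β s * G s) ≤ κ * G s :=
      mul_le_mul_of_nonneg_left (mul_le_of_le_one_left h3 h6) hκ0.le
    simp only [hA] at h2
    linarith

end IsMoment

/-- A function growing by a superlinear power law must blow up before a time determined by
its a priori size. -/
lemma time_le_of_superlinear {F : ℝ → ℝ} {c b p a B t₁ : ℝ} (hc : 0 < c) (hb : 0 ≤ b)
    (hp : 1 < p) (hB : 0 < B) (hΓ : 0 < 2 - b + a * (p - 1)) (ht₁ : 4 < t₁)
    (hmono : MonotoneOn F (Icc 0 t₁))
    (hstep : ∀ t r, 1 ≤ t → 0 ≤ r → t + r ≤ t₁ →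
      c * (1 + (t + r)) ^ (-b) * r ^ 2 * F t ^ p ≤ F (t + r))
    (hlow : ∀ t ∈ Icc 2 t₁, B * t ^ a ≤ F t) :
    t₁ ≤ 2 * (4 * 4 ^ (1 / (p - 1)) / (c * 4 ^ (-b))) ^ (1 / (2 - b + a * (p - 1)))
      * B ^ (-((p - 1) / (2 - b + a * (p - 1)))) := by
  set Γ := 2 - b + a * (p - 1) with hΓdef
  set X : ℝ := 4 ^ (1 / (p - 1)) with hX
  have hp1 : 0 < p - 1 := by linarith
  have hX1 : 1 < X := Real.one_lt_rpow (by norm_num) (by positivity)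
  have hXp : X ^ (p - 1) = 4 := by
    rw [hX, ← Real.rpow_mul (by norm_num), one_div_mul_cancel hp1.ne', Real.rpow_one]
  set τ := t₁ / 2 with hτ
  have hτ2 : 2 < τ := by rw [hτ]; linarith
  have hτ0 : 0 < τ := by linarith
  set F₀ := F τ with hF₀
  have hlow0 : B * τ ^ a ≤ F₀ := hlow τ ⟨hτ2.le, by rw [hτ]; linarith⟩
  have hF₀pos : 0 < F₀ := lt_of_lt_of_le (by positivity) hlow0
  -- Otherwise F grows at least by the factor X at each of the times τ(2 − 2^{-j}), which all lie
  -- before t₁ = 2τ. Halving the step loses a factor 4 in r², and X^{p−1} = 4 regains it.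
  have hS : c * 4 ^ (-b) * τ ^ (2 - b) * F₀ ^ (p - 1) < 4 * X := by
    by_contra! hS
    have hτj : ∀ j : ℕ, τ ≤ τ * (2 - (1 / 2) ^ j) ∧ τ * (2 - (1 / 2) ^ j) ≤ t₁ := by
      intro j
      have h1 : (1 / 2 : ℝ) ^ j ≤ 1 := pow_le_one₀ (by norm_num) (by norm_num)
      have h2 : (0 : ℝ) < (1 / 2) ^ j := by positivity
      constructor
      · nlinarith
      · have : t₁ = 2 * τ := by rw [hτ]; ring
        rw [this]
        nlinarith
    have hind : ∀ j : ℕ, F₀ * X ^ j ≤ F (τ * (2 - (1 / 2) ^ j)) := by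
      intro j
      induction j with
      | zero => norm_num [hF₀]
      | succ j ih =>
        have heq : τ * (2 - (1 / 2) ^ (j + 1))
            = τ * (2 - (1 / 2) ^ j) + τ * (1 / 2) ^ (j + 1) := by ring
        have h0 := hτj (j + 1)
        have h1 := hstep (τ * (2 - (1 / 2) ^ j)) (τ * (1 / 2) ^ (j + 1))
          (by linarith [(hτj j).1]) (by positivity) (heq ▸ h0.2)
        rw [← heq] at h1
        refine le_trans ?_ h1
        -- All times are at most 2τ and τ > 2, so the decaying weight is bounded below by its value
        -- at 4τ.
        have h2 : (4 * τ) ^ (-b) ≤ (1 + τ * (2 - (1 / 2) ^ (j + 1))) ^ (-b) := by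
          refine Real.rpow_le_rpow_of_nonpos (by linarith) ?_ (by linarith)
          have := h0.2
          rw [hτ] at hτ2 this ⊢
          linarith
        have h3 : (F₀ * X ^ j) ^ p ≤ F (τ * (2 - (1 / 2) ^ j)) ^ p :=
          Real.rpow_le_rpow (by positivity) ih (by linarith)
        have h4 : (F₀ * X ^ j) ^ p = F₀ * F₀ ^ (p - 1) * (X ^ j * 4 ^ j) := by
          have hsplit : ∀ x : ℝ, 0 < x → x ^ p = x * x ^ (p - 1) := by
            intro x hx
            rw [mul_comm, ← Real.rpow_add_one hx.ne', sub_add_cancel]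
          rw [hsplit _ (by positivity), Real.mul_rpow hF₀pos.le (by positivity),
            ← Real.rpow_pow_comm (by positivity), hXp]
          ring
        calc F₀ * X ^ (j + 1) = F₀ * X ^ j * (4 * X) / 4 := by rw [pow_succ]; ring
          _ ≤ F₀ * X ^ j * (c * 4 ^ (-b) * τ ^ (2 - b) * F₀ ^ (p - 1)) / 4 := by gcongr
          _ = c * (4 * τ) ^ (-b) * (τ * (1 / 2) ^ (j + 1)) ^ 2 * (F₀ * X ^ j) ^ p := by
            have h5 : τ ^ (2 - b) = τ ^ (-b) * τ ^ 2 := by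
              rw [← Real.rpow_natCast τ 2, ← Real.rpow_add hτ0]
              congr 1
              push_cast
              ring
            have h6 : ((1 / 2 : ℝ) ^ (j + 1)) ^ 2 * 4 ^ j = 1 / 4 := by
              have h7 : ((1 / 2 : ℝ) ^ j) ^ 2 * 4 ^ j = 1 := by
                rw [← pow_mul, mul_comm j 2, pow_mul, ← mul_pow]
                norm_num
              rw [pow_succ (1 / 2 : ℝ) j, mul_pow]
              linear_combination h7 / 4
            rw [h4, h5, Real.mul_rpow (by norm_num) hτ0.le, mul_pow τ]
            linear_combination (-(c * 4 ^ (-b) * τ ^ (-b) * τ ^ 2 * F₀ * F₀ ^ (p - 1) * X ^ j)) * h6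
          _ ≤ _ := by
            have h5 : 0 < 1 + τ * (2 - (1 / 2) ^ (j + 1)) := by linarith
            gcongr
    -- Monotonicity bounds every value by F t₁, against the geometric growth.
    obtain ⟨j, hj⟩ := pow_unbounded_of_one_lt (F t₁ / F₀) hX1
    rw [div_lt_iff₀ hF₀pos] at hj
    have h1 := hτj j
    have h2 : F (τ * (2 - (1 / 2) ^ j)) ≤ F t₁ :=
      hmono ⟨by linarith, h1.2⟩ ⟨by linarith, le_rfl⟩ h1.2
    have := hind j
    linarith
  -- Inserting the a priori growth turns the smallness condition into an upper bound for τ^Γ.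
  have h1 : B ^ (p - 1) * τ ^ (a * (p - 1)) ≤ F₀ ^ (p - 1) := by
    rw [Real.rpow_mul hτ0.le, ← Real.mul_rpow hB.le (by positivity)]
    exact Real.rpow_le_rpow (by positivity) hlow0 hp1.le
  have h2 : c * 4 ^ (-b) * B ^ (p - 1) * τ ^ Γ < 4 * X := by
    refine lt_of_le_of_lt ?_ hS
    rw [hΓdef, Real.rpow_add hτ0]
    calc _ = c * 4 ^ (-b) * τ ^ (2 - b) * (B ^ (p - 1) * τ ^ (a * (p - 1))) := by ring
      _ ≤ _ := by gcongr
  have h3 : τ ^ Γ ≤ 4 * X / (c * 4 ^ (-b)) * B ^ (-(p - 1)) := by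
    rw [Real.rpow_neg hB.le, ← div_eq_mul_inv, div_div, le_div_iff₀ (by positivity)]
    linarith
  have h4 : τ = (τ ^ Γ) ^ (1 / Γ) := by
    rw [← Real.rpow_mul hτ0.le, mul_one_div_cancel hΓ.ne', Real.rpow_one]
  have h5 : τ ≤ (4 * X / (c * 4 ^ (-b)) * B ^ (-(p - 1))) ^ (1 / Γ) := by
    rw [h4]
    exact Real.rpow_le_rpow (by positivity) h3 (by positivity)
  rw [Real.mul_rpow (by positivity) (by positivity), ← Real.rpow_mul hB.le] at h5
  have h6 : -(p - 1) * (1 / Γ) = -((p - 1) / Γ) := by ring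
  rw [h6] at h5
  have : t₁ = 2 * τ := by rw [hτ]; ring
  linarith

/-! ### Exponential integrals over balls -/

lemma lintegral_prod_pi {n : ℕ} (f : Fin n → ℝ → ℝ≥0∞) (hf : ∀ i, Measurable (f i)) :
    ∫⁻ x : Fin n → ℝ, ∏ i, f i (x i) = ∏ i, ∫⁻ t, f i t := by
  induction n with
  | zero => simp [volume_pi]
  | succ n ih =>
    rw [← ((volume_preserving_piFinSuccAbove (fun _ : Fin (n + 1) => ℝ) 0).symm
      (MeasurableEquiv.piFinSuccAbove _ 0)).lintegral_comp_emb
      (MeasurableEquiv.measurableEmbedding _)]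
    simp only [MeasurableEquiv.piFinSuccAbove_symm_apply, Fin.prod_univ_succ,
      Fin.insertNthEquiv, Fin.insertNth_zero, Equiv.coe_fn_mk, Fin.cons_zero, Fin.cons_succ]
    have hm : Measurable fun y : Fin n → ℝ => ∏ i : Fin n, f i.succ (y i) :=
      Finset.measurable_fun_prod _ fun i _ => (hf i.succ).comp (measurable_pi_apply i)
    rw [← ih _ fun i => hf i.succ]
    exact lintegral_prod_mul (hf 0).aemeasurable hm.aemeasurable

lemma lintegral_gaussian {c : ℝ} (hc : 0 < c) :
    ∫⁻ t : ℝ, ENNReal.ofReal (Real.exp (-c * t ^ 2)) = ENNReal.ofReal √(Real.pi / c) := by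
  rw [← ofReal_integral_eq_lintegral_ofReal (integrable_exp_neg_mul_sq hc)
    (ae_of_all _ fun _ => (Real.exp_pos _).le), integral_gaussian]

lemma exists_basis_of_unit {n : ℕ} (i₀ : Fin n) {e : Space n} (he : ‖e‖ = 1) :
    ∃ b : OrthonormalBasis (Fin n) ℝ (Space n), b i₀ = e := by
  obtain ⟨b, hb⟩ := Orthonormal.exists_orthonormalBasis_extension_of_card_eq (𝕜 := ℝ)
    (E := Space n) (ι := Fin n) (by simp) (v := fun _ => e) (s := {i₀}) (by
      rw [orthonormal_subsingleton_iff]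
      intro i
      simpa using he)
  exact ⟨b, hb i₀ rfl⟩

/-- Integral of a function of `⟪e, x⟫` times a Gaussian in the directions orthogonal to `e`. -/
lemma lintegral_strip {n : ℕ} (hn : 1 ≤ n) {e : Space n} (he : ‖e‖ = 1) {c : ℝ} (hc : 0 < c)
    {h : ℝ → ℝ≥0∞} (hh : Measurable h) :
    ∫⁻ x : Space n, h (inner ℝ e x) *
        ENNReal.ofReal (Real.exp (-c * (‖x‖ ^ 2 - inner ℝ e x ^ 2)))
      = (∫⁻ t, h t) * ENNReal.ofReal √(Real.pi / c) ^ (n - 1) := by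
  obtain ⟨m, rfl⟩ : ∃ m, n = m + 1 := ⟨n - 1, by omega⟩
  -- Rotate so that e is the first axis. The integrand becomes a product over coordinates, with n −
  -- 1 Gaussian factors.
  obtain ⟨b, hb⟩ := exists_basis_of_unit (0 : Fin (m + 1)) he
  have hmp : MeasurePreserving (fun x => WithLp.ofLp (b.repr x)) (volume : Measure (Space (m + 1)))
      volume := (PiLp.volume_preserving_ofLp (Fin (m + 1))).comp b.measurePreserving_repr
  set f : Fin (m + 1) → ℝ → ℝ≥0∞ := Fin.cons h
    fun _ t => ENNReal.ofReal (Real.exp (-c * t ^ 2)) with hf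
  have hfm : ∀ i, Measurable (f i) := by
    intro i
    refine Fin.cases ?_ (fun j => ?_) i
    · simpa [hf] using hh
    · simp only [hf, Fin.cons_succ]
      fun_prop
  have key := lintegral_prod_pi f hfm
  have hm : Measurable fun y : Fin (m + 1) → ℝ => ∏ i, f i (y i) :=
    Finset.measurable_fun_prod _ fun i _ => (hfm i).comp (measurable_pi_apply i)
  rw [← hmp.lintegral_comp hm] at key
  have hrhs : ∏ i, ∫⁻ t, f i t = (∫⁻ t, h t) * ENNReal.ofReal √(Real.pi / c) ^ m := by
    rw [Fin.prod_univ_succ]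
    simp only [hf, Fin.cons_zero, Fin.cons_succ, lintegral_gaussian hc, Finset.prod_const,
      Finset.card_univ, Fintype.card_fin]
  rw [hrhs] at key
  rw [Nat.add_sub_cancel, ← key]
  refine lintegral_congr fun x => ?_
  have h0 : b.repr x 0 = inner ℝ e x := by rw [b.repr_apply_apply, hb]
  have hnorm : ‖x‖ ^ 2 - inner ℝ e x ^ 2 = ∑ i : Fin m, b.repr x i.succ ^ 2 := by
    rw [← b.repr.norm_map x, EuclideanSpace.norm_sq_eq, Fin.sum_univ_succ, ← h0]
    simp
  rw [Fin.prod_univ_succ, hnorm]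
  simp only [hf, Fin.cons_zero, Fin.cons_succ, h0]
  rw [← ENNReal.ofReal_prod_of_nonneg fun _ _ => (Real.exp_pos _).le, ← Real.exp_sum,
    Finset.mul_sum]

lemma exists_unit_smul {n : ℕ} (hn : 1 ≤ n) (x : Space n) :
    ∃ e : Space n, ‖e‖ = 1 ∧ x = ‖x‖ • e := by
  by_cases hx : x = 0
  · exact ⟨EuclideanSpace.single ⟨0, hn⟩ 1, by simp, by simp [hx]⟩
  · have : ‖x‖ ≠ 0 := norm_ne_zero_iff.2 hx
    exact ⟨‖x‖⁻¹ • x, by simp [norm_smul, this], by simp [smul_smul, this]⟩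

lemma sqrt_div_pow_eq {n : ℕ} (hn : 1 ≤ n) {c ρ : ℝ} (hc : 0 ≤ c) (hρ : 0 < ρ) :
    √(c / ρ) ^ (n - 1) = √c ^ (n - 1) * ρ ^ (-(((n : ℝ) - 1) / 2)) := by
  rw [Real.sqrt_div hc, div_pow, div_eq_mul_inv, Real.sqrt_eq_rpow ρ, ← Real.rpow_natCast,
    ← Real.rpow_natCast, ← Real.rpow_mul hρ.le, Real.rpow_neg hρ.le, Nat.cast_sub hn]
  congr 3
  push_cast
  ring

lemma sqrt_mul_pow_eq {n : ℕ} (hn : 1 ≤ n) {c ρ : ℝ} (hc : 0 ≤ c) (hρ : 0 < ρ) :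
    √(c * ρ) ^ (n - 1) = √c ^ (n - 1) * ρ ^ (((n : ℝ) - 1) / 2) := by
  rw [Real.sqrt_mul hc, mul_pow, Real.sqrt_eq_rpow ρ, ← Real.rpow_natCast (ρ ^ (1 / 2 : ℝ)),
    ← Real.rpow_mul hρ.le, Nat.cast_sub hn]
  congr 2
  push_cast
  ring

/-- Superposition over frequencies decays like `ρ ^ (-(n-1)/2)`. -/
lemma lintegral_frequency_le {n : ℕ} (hn : 1 ≤ n) {ρ : ℝ} (hρ : 0 < ρ) {x : Space n}
    (hx : ‖x‖ ≤ ρ) {D : Set (Space n)} (hDm : MeasurableSet D) (hD : ∀ ξ ∈ D, ‖ξ‖ ≤ 2) :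
    ∫⁻ ξ in D, ENNReal.ofReal (Real.exp (inner ℝ x ξ - ‖ξ‖ * ρ))
      ≤ ENNReal.ofReal (4 * √(4 * Real.pi) ^ (n - 1) * ρ ^ (-(((n : ℝ) - 1) / 2))) := by
  obtain ⟨e, he, hxe⟩ := exists_unit_smul hn x
  set h : ℝ → ℝ≥0∞ := (Icc (-2 : ℝ) 2).indicator 1 with hh
  have hhm : Measurable h := measurable_one.indicator measurableSet_Icc
  have hint : ∫⁻ t, h t = ENNReal.ofReal 4 := by
    rw [hh, lintegral_indicator measurableSet_Icc]
    simp [Real.volume_Icc]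
    norm_num
  have key := lintegral_strip hn he (c := ρ / 4) (by positivity) hhm
  calc ∫⁻ ξ in D, ENNReal.ofReal (Real.exp (inner ℝ x ξ - ‖ξ‖ * ρ))
      ≤ ∫⁻ ξ in D, h (inner ℝ e ξ) *
        ENNReal.ofReal (Real.exp (-(ρ / 4) * (‖ξ‖ ^ 2 - inner ℝ e ξ ^ 2))) := by
        refine setLIntegral_mono' hDm fun ξ hξ => ?_
        have h1 := hD ξ hξ
        have h2 : |inner ℝ e ξ| ≤ ‖ξ‖ := by
          have := abs_real_inner_le_norm e ξ
          rwa [he, one_mul] at this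
        have h3 := abs_le.1 h2
        have h4 : (inner ℝ e ξ : ℝ) ∈ Icc (-2 : ℝ) 2 := ⟨by linarith, by linarith⟩
        rw [hh, indicator_of_mem h4, Pi.one_apply, one_mul]
        refine ENNReal.ofReal_le_ofReal (Real.exp_le_exp.2 ?_)
        have h5 : inner ℝ x ξ = ‖x‖ * inner ℝ e ξ := by
          conv_lhs => rw [hxe]
          rw [real_inner_smul_left]
        rw [h5]
        set y : ℝ := inner ℝ e ξ
        have h6 := norm_nonneg x
        have h7 := norm_nonneg ξ
        rcases le_or_gt y 0 with hy | hy
        · have h8 : ‖x‖ * y ≤ 0 := mul_nonpos_of_nonneg_of_nonpos h6 hy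
          have h9 : 0 ≤ ρ * (‖ξ‖ * (2 - ‖ξ‖)) := by
            have : 0 ≤ 2 - ‖ξ‖ := by linarith
            positivity
          nlinarith [mul_nonneg hρ.le (sq_nonneg y), mul_nonneg hρ.le h7]
        -- The exponent is at most −ρ(‖ξ‖ − y), and ‖ξ‖ + y ≤ 4 turns this into the Gaussian
        -- exponent −(ρ/4)(‖ξ‖² − y²).
        · have h8 : ‖x‖ * y ≤ ρ * y := mul_le_mul_of_nonneg_right hx hy.le
          have h9 : 0 ≤ ρ * ((‖ξ‖ - y) * (4 - (‖ξ‖ + y))) :=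
            mul_nonneg hρ.le (mul_nonneg (by linarith) (by linarith))
          nlinarith
    _ ≤ _ := setLIntegral_le_lintegral _ _
    _ = _ := by
      rw [key, hint, ← ENNReal.ofReal_pow (Real.sqrt_nonneg _), ← ENNReal.ofReal_mul (by norm_num)]
      congr 1
      rw [mul_assoc (4 : ℝ), ← sqrt_div_pow_eq hn (by positivity) hρ]
      congr 3
      field_simp

/-- Exponential integrals over balls of radius `ρ`. -/
lemma integral_exp_ball_le {n : ℕ} (hn : 1 ≤ n) {ρ : ℝ} (hρ : 0 < ρ) {ξ : Space n}
    (hξ : 1 ≤ ‖ξ‖) :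
    ∫ x in Metric.closedBall (0 : Space n) ρ, Real.exp (inner ℝ x ξ - ‖ξ‖ * ρ)
      ≤ 2 * √(4 * Real.pi) ^ (n - 1) * ρ ^ (((n : ℝ) - 1) / 2) := by
  obtain ⟨e, he, hxe⟩ := exists_unit_smul hn ξ
  set h : ℝ → ℝ≥0∞ := (Iic ρ).indicator
    fun t => ENNReal.ofReal (Real.exp (-ρ / 2) * Real.exp ((1 / 2) * t)) with hh
  have hhm : Measurable h := Measurable.indicator (by fun_prop) measurableSet_Iic
  have hint : ∫⁻ t, h t = ENNReal.ofReal 2 := by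
    rw [hh, lintegral_indicator measurableSet_Iic, ← ofReal_integral_eq_lintegral_ofReal
      ((integrableOn_exp_mul_Iic (by norm_num) ρ).const_mul _)
      (ae_of_all _ fun _ => by positivity), integral_const_mul,
      integral_exp_mul_Iic (by norm_num)]
    congr 1
    rw [← mul_div_assoc, ← Real.exp_add]
    have : -ρ / 2 + 1 / 2 * ρ = 0 := by ring
    rw [this, Real.exp_zero]
    norm_num
  have key := lintegral_strip hn he (c := 1 / (4 * ρ)) (by positivity) hhm
  rw [integral_eq_lintegral_of_nonneg_ae (ae_of_all _ fun _ => (Real.exp_pos _).le)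
    (by fun_prop : Continuous fun x : Space n =>
      Real.exp (inner ℝ x ξ - ‖ξ‖ * ρ)).aestronglyMeasurable]
  refine ENNReal.toReal_le_of_le_ofReal (by positivity) ?_
  calc ∫⁻ x in Metric.closedBall (0 : Space n) ρ,
        ENNReal.ofReal (Real.exp (inner ℝ x ξ - ‖ξ‖ * ρ))
      ≤ ∫⁻ x in Metric.closedBall (0 : Space n) ρ, h (inner ℝ e x) *
        ENNReal.ofReal (Real.exp (-(1 / (4 * ρ)) * (‖x‖ ^ 2 - inner ℝ e x ^ 2))) := by
        refine setLIntegral_mono' Metric.isClosed_closedBall.measurableSet fun x hx => ?_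
        rw [mem_closedBall_zero_iff] at hx
        have h2 : |inner ℝ e x| ≤ ‖x‖ := by
          have := abs_real_inner_le_norm e x
          rwa [he, one_mul] at this
        have h3 := abs_le.1 h2
        have h4 : (inner ℝ e x : ℝ) ∈ Iic ρ := by
          rw [mem_Iic]
          linarith
        rw [hh, indicator_of_mem h4, ← Real.exp_add, ← ENNReal.ofReal_mul (Real.exp_pos _).le,
          ← Real.exp_add]
        refine ENNReal.ofReal_le_ofReal (Real.exp_le_exp.2 ?_)
        have h5 : inner ℝ x ξ = ‖ξ‖ * inner ℝ e x := by
          conv_lhs => rw [hxe]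
          rw [real_inner_smul_right, real_inner_comm]
        rw [h5]
        set y : ℝ := inner ℝ e x
        have hy : y ≤ ρ := h4
        have h6 := norm_nonneg x
        -- Half of y − ρ is kept as the one-dimensional exponential in h; the other half dominates
        -- the Gaussian exponent, because ‖x‖ ≤ ρ and ρ + y ≤ 2ρ.
        have h7 : ‖ξ‖ * y - ‖ξ‖ * ρ ≤ y - ρ := by nlinarith
        have h8 : (‖x‖ ^ 2 - y ^ 2) / (4 * ρ) ≤ (ρ - y) / 2 := by
          rw [div_le_iff₀ (by positivity)]
          have h9 : ‖x‖ ^ 2 ≤ ρ ^ 2 := pow_le_pow_left₀ h6 hx 2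
          nlinarith [mul_nonneg (sub_nonneg.2 hy) (sub_nonneg.2 hy)]
        have h10 : -(1 / (4 * ρ)) * (‖x‖ ^ 2 - y ^ 2) = -((‖x‖ ^ 2 - y ^ 2) / (4 * ρ)) := by ring
        rw [h10]
        linarith
    _ ≤ _ := setLIntegral_le_lintegral _ _
    _ = _ := by
      rw [key, hint, ← ENNReal.ofReal_pow (Real.sqrt_nonneg _), ← ENNReal.ofReal_mul (by norm_num),
        mul_assoc (2 : ℝ), ← sqrt_mul_pow_eq hn (by positivity) hρ]
      congr 4
      field_simp

/-! ### Moments of energy solutions -/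

/-- A cut-off exponential, used as the spatial part of test functions. -/
def expTest {n : ℕ} (η : ContDiffBump (0 : Space n)) (ξ x : Space n) : ℝ :=
  η x * Real.exp (inner ℝ x ξ)

section expTest

variable {n : ℕ} (η : ContDiffBump (0 : Space n)) (ξ : Space n)

lemma contDiff_expTest : ContDiff ℝ ∞ (expTest η ξ) :=
  η.contDiff.mul (contDiff_id.inner ℝ contDiff_const).exp

lemma hasCompactSupport_expTest : HasCompactSupport (expTest η ξ) :=
  η.hasCompactSupport.mul_right

lemma continuous_expTest : Continuous (expTest η ξ) := (contDiff_expTest η ξ).continuous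

lemma expTest_nonneg (x : Space n) : 0 ≤ expTest η ξ x := mul_nonneg η.nonneg (Real.exp_pos _).le

variable {η ξ}

lemma expTest_eq {x : Space n} (hx : ‖x‖ ≤ η.rIn) : expTest η ξ x = Real.exp (inner ℝ x ξ) := by
  rw [expTest, η.one_of_mem_closedBall (by simpa using hx), one_mul]

lemma hasFDerivAt_exp_inner (x : Space n) :
    HasFDerivAt (fun y : Space n => Real.exp (inner ℝ y ξ))
      (Real.exp (inner ℝ x ξ) • innerSL ℝ ξ) x := by
  have h : HasFDerivAt (fun y : Space n => inner ℝ ξ y) (innerSL ℝ ξ) x :=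
    (innerSL ℝ ξ).hasFDerivAt
  simpa only [real_inner_comm] using h.exp

lemma fderiv_expTest {x : Space n} (hx : ‖x‖ < η.rIn) (v : Space n) :
    fderiv ℝ (expTest η ξ) x v = inner ℝ ξ v * Real.exp (inner ℝ x ξ) := by
  have h : expTest η ξ =ᶠ[𝓝 x] fun y => Real.exp (inner ℝ y ξ) := by
    filter_upwards [(isOpen_lt continuous_norm continuous_const).mem_nhds hx] with y hy
    exact expTest_eq hy.le
  rw [h.fderiv_eq, (hasFDerivAt_exp_inner x).fderiv]
  simp [mul_comm]

lemma fderiv_fderiv_expTest {x : Space n} (hx : ‖x‖ < η.rIn) (v : Space n) :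
    fderiv ℝ (fun y => fderiv ℝ (expTest η ξ) y v) x v = inner ℝ ξ v ^ 2 * expTest η ξ x := by
  have h : (fun y => fderiv ℝ (expTest η ξ) y v)
      =ᶠ[𝓝 x] fun y => inner ℝ ξ v * Real.exp (inner ℝ y ξ) := by
    filter_upwards [(isOpen_lt continuous_norm continuous_const).mem_nhds hx] with y hy
    exact fderiv_expTest hy v
  rw [h.fderiv_eq, ((hasFDerivAt_exp_inner x).const_mul _).fderiv, expTest_eq hx.le]
  simp
  ring

/-- For `u ∈ H¹` supported where the cut-off equals one, the Dirichlet pairing with a cut-off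
exponential is a multiple of the `L²` pairing. -/
lemma integral_fderiv_expTest_grad {u : H1 n} {r : ℝ} (hr : r < η.rIn)
    (hu : ∀ᵐ x : Space n, r < ‖x‖ → fn u x = 0) :
    ∫ x, fderiv ℝ (expTest η ξ) x (grad u x) = -(‖ξ‖ ^ 2 * ∫ x, fn u x * expTest η ξ x) := by
  set b := EuclideanSpace.basisFun (Fin n) ℝ with hb
  have hsm : ∀ i, ContDiff ℝ ∞ fun x => fderiv ℝ (expTest η ξ) x (b i) := fun i =>
    ((contDiff_expTest η ξ).fderiv_right (by simp)).clm_apply contDiff_const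
  have hcs : ∀ i, HasCompactSupport fun x => fderiv ℝ (expTest η ξ) x (b i) := fun i =>
    (hasCompactSupport_expTest η ξ).fderiv_apply ℝ (b i)
  have h1 : ∀ x, fderiv ℝ (expTest η ξ) x (grad u x)
      = ∑ i, inner ℝ (grad u x) (b i) * fderiv ℝ (expTest η ξ) x (b i) := by
    intro x
    conv_lhs => rw [← b.sum_repr (grad u x)]
    rw [map_sum]
    refine Finset.sum_congr rfl fun i _ => ?_
    rw [map_smul, b.repr_apply_apply, smul_eq_mul, real_inner_comm]
  simp_rw [h1]
  rw [integral_finsetSum _ fun i _ =>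
    integrable_inner_mul_test (grad u) (b i) (hsm i).continuous (hcs i)]
  have h2 : ∀ i, ∫ x, inner ℝ (grad u x) (b i) * fderiv ℝ (expTest η ξ) x (b i)
      = -(inner ℝ ξ (b i) ^ 2 * ∫ x, fn u x * expTest η ξ x) := by
    -- The weak gradient is tested against ∂ᵢ of the cut-off exponential. On the support of u a
    -- second derivative only multiplies by ⟪ξ, bᵢ⟫².
    intro i
    have h3 := u.2 _ (hsm i) (hcs i) (b i)
    have h4 : ∫ x, inner ℝ (grad u x) (b i) * fderiv ℝ (expTest η ξ) x (b i)
        = -∫ x, fn u x * fderiv ℝ (fun y => fderiv ℝ (expTest η ξ) y (b i)) x (b i) := by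
      rw [eq_neg_iff_add_eq_zero, ← eq_neg_iff_add_eq_zero.1 h3, add_comm]
      rfl
    rw [h4, ← integral_const_mul]
    congr 1
    refine integral_congr_ae ?_
    filter_upwards [hu] with x hx
    by_cases hxr : r < ‖x‖
    · rw [hx hxr]
      ring
    · rw [fderiv_fderiv_expTest ((not_lt.1 hxr).trans_lt hr)]
      ring
  simp_rw [h2]
  rw [Finset.sum_neg_distrib, ← Finset.sum_mul]
  congr 2
  have := b.sum_sq_norm_inner_left ξ
  simpa using this

end expTest

/-- A moment is a bounded functional on L², so it inherits the C¹ regularity in time of the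
solution. -/
lemma exists_pairing {n : ℕ} {ψ : Space n → ℝ} (hψ : Continuous ψ) (hc : HasCompactSupport ψ) :
    ∃ l : L2 n →L[ℝ] ℝ, ∀ u : L2 n, l u = ∫ x, u x * ψ x := by
  have hm : MemLp ψ 2 volume := hψ.memLp_of_hasCompactSupport hc
  refine ⟨innerSL ℝ (hm.toLp ψ), fun u => ?_⟩
  rw [innerSL_apply_apply, L2.inner_def]
  refine integral_congr_ae ?_
  filter_upwards [hm.coeFn_toLp] with x hx
  rw [hx]
  simp

lemma Icc_subset_timeInterval {T : ℝ≥0∞} {t₁ : ℝ} (hT : ENNReal.ofReal t₁ < T) :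
    Icc 0 t₁ ⊆ timeInterval T :=
  fun _ ht => ⟨ht.1, (ENNReal.ofReal_le_ofReal ht.2).trans_lt hT⟩

lemma timeInterval_mem_nhds {T : ℝ≥0∞} {t₁ t : ℝ} (hT : ENNReal.ofReal t₁ < T)
    (ht : t ∈ Ioo 0 t₁) : timeInterval T ∈ 𝓝 t :=
  mem_of_superset (Icc_mem_nhds ht.1 ht.2) (Icc_subset_timeInterval hT)

lemma uniqueDiffOn_timeInterval {T : ℝ≥0∞} {t₁ : ℝ} (ht₁ : 0 < t₁)
    (hT : ENNReal.ofReal t₁ < T) : UniqueDiffOn ℝ (timeInterval T) := by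
  refine uniqueDiffOn_convex (OrdConnected.convex ⟨?_⟩) ?_
  · intro x hx y hy z hz
    exact ⟨hx.1.trans hz.1, (ENNReal.ofReal_le_ofReal hz.2).trans_lt hy.2⟩
  · refine ⟨t₁ / 2, mem_interior_iff_mem_nhds.2 (timeInterval_mem_nhds hT ⟨?_, ?_⟩)⟩ <;> linarith

/-- The time cut-off is 1 in a neighbourhood of each point of [0, t₁], so that its time derivative
drops out of the weak formulation there. -/
lemma exists_testFunction {n : ℕ} {T : ℝ≥0∞} {t₁ : ℝ} (ht₁ : 0 ≤ t₁)
    (hT : ENNReal.ofReal t₁ < T) {ψ : Space n → ℝ} (hψ : ContDiff ℝ ∞ ψ)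
    (hc : HasCompactSupport ψ) :
    ∃ χ : ℝ → ℝ, IsTestFunction T (fun z : ℝ × Space n => χ z.1 * ψ z.2) ∧
      ∀ s ∈ Icc 0 t₁, χ =ᶠ[𝓝 s] fun _ => 1 := by
  obtain ⟨t₂, ht₂0, ht₂, ht₂T⟩ := ENNReal.lt_iff_exists_real_btwn.1 hT
  have h12 : t₁ < t₂ := (ENNReal.ofReal_lt_ofReal_iff_of_nonneg ht₁).1 ht₂
  let χ : ContDiffBump (0 : ℝ) := ⟨(t₁ + t₂) / 2, t₂, by linarith, by linarith⟩
  have hK : IsCompact (Metric.closedBall (0 : ℝ) t₂ ×ˢ tsupport ψ) :=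
    (isCompact_closedBall 0 t₂).prod hc
  have hsupp : Function.support (fun z : ℝ × Space n => χ z.1 * ψ z.2)
      ⊆ Metric.closedBall (0 : ℝ) t₂ ×ˢ tsupport ψ := by
    intro z hz
    have hz1 : χ z.1 ≠ 0 := left_ne_zero_of_mul hz
    have hz2 : ψ z.2 ≠ 0 := right_ne_zero_of_mul hz
    have h3 : z.1 ∈ Function.support χ := hz1
    rw [χ.support_eq] at h3
    exact ⟨Metric.ball_subset_closedBall h3, subset_tsupport ψ hz2⟩
  refine ⟨χ, ⟨?_, HasCompactSupport.of_support_subset_isCompact hK hsupp, ?_⟩, ?_⟩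
  · exact (χ.contDiff.comp contDiff_fst).mul (hψ.comp contDiff_snd)
  · intro z hz
    have h := closure_minimal hsupp hK.isClosed hz
    have h1 : z.1 ∈ Metric.closedBall (0 : ℝ) t₂ := h.1
    rw [mem_closedBall_zero_iff, Real.norm_eq_abs] at h1
    exact (ENNReal.ofReal_le_ofReal ((le_abs_self _).trans h1)).trans_lt ht₂T
  · intro s hs
    refine χ.eventuallyEq_one_of_mem_ball ?_
    rw [mem_ball_zero_iff, Real.norm_eq_abs, abs_of_nonneg hs.1]
    change s < (t₁ + t₂) / 2
    linarith [hs.2]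

section moments

variable {n : ℕ} {ν₁ ν₂ β p ε R : ℝ} {f : H1 n} {g : L2 n} {T : ℝ≥0∞} {w : ℝ → H1 n}

/-- The support of w(t) lies inside the region where the cut-off equals 1, so the Dirichlet term
reproduces ‖ξ‖² times the moment with no cut-off error. -/
lemma isMoment_of_isEnergySolution (hw : IsEnergySolution ν₁ ν₂ β p ε f g T w)
    (hs : SupportedInCone R T w) {t₁ : ℝ} (ht₁ : 0 < t₁) (hT : ENNReal.ofReal t₁ < T)
    {η : ContDiffBump (0 : Space n)} (hη : t₁ + R < η.rIn) (ξ : Space n) :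
    IsMoment ν₁ β (-ν₂) ‖ξ‖ t₁ (fun t => ∫ x, fn (w t) x * expTest η ξ x)
      (fun t => ∫ x, timeDeriv T w t x * expTest η ξ x)
      (fun t => ∫ x, |fn (w t) x| ^ p * expTest η ξ x) := by
  obtain ⟨l, hl⟩ := exists_pairing (continuous_expTest η ξ) (hasCompactSupport_expTest η ξ)
  obtain ⟨χ, hφ, hχ⟩ := exists_testFunction ht₁.le hT (contDiff_expTest η ξ)
    (hasCompactSupport_expTest η ξ)
  have hχ1 : ∀ s ∈ Icc 0 t₁, χ s = 1 := fun s hs => (hχ s hs).eq_of_nhds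
  have hsub := Icc_subset_timeInterval hT
  have hcG : ContinuousOn (fun t => ∫ x, fn (w t) x * expTest η ξ x) (Icc 0 t₁) := by
    simp_rw [← hl]
    exact l.continuous.comp_continuousOn (hw.contDiffOn.continuousOn.mono hsub)
  have hcH : ContinuousOn (fun t => ∫ x, timeDeriv T w t x * expTest η ξ x) (Icc 0 t₁) := by
    simp_rw [← hl]
    exact l.continuous.comp_continuousOn ((hw.contDiffOn.continuousOn_derivWithin
      (uniqueDiffOn_timeInterval ht₁ hT) le_rfl).mono hsub)
  have hNeq : ∀ s ∈ Icc 0 t₁, ∫ x, |fn (w s) x| ^ p * (χ s * expTest η ξ x)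
      = ∫ x, |fn (w s) x| ^ p * expTest η ξ x := fun s hs => by simp_rw [hχ1 s hs, one_mul]
  refine ⟨hcG, hcH, ?_, ?_, ?_, ?_⟩
  · intro t ht
    simp_rw [← hl]
    refine l.hasFDerivAt.comp_hasDerivAt t ?_
    exact ((hw.contDiffOn.differentiableOn one_ne_zero) t
      (hsub (Ioo_subset_Icc_self ht))).hasDerivWithinAt.hasDerivAt (timeInterval_mem_nhds hT ht)
  · intro t _
    exact integral_nonneg fun x => mul_nonneg (by positivity) (expTest_nonneg η ξ x)
  · refine (hw.integrable _ hφ t₁ (hsub ⟨ht₁.le, le_rfl⟩)).congr fun s hs' => ?_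
    rw [uIoc_of_le ht₁.le] at hs'
    exact hNeq s ⟨hs'.1.le, hs'.2⟩
  · intro t ht
    have hsub' : Icc 0 t ⊆ Icc 0 t₁ := Icc_subset_Icc_right ht.2
    have hsub'' : Set.uIcc 0 t ⊆ Icc 0 t₁ := by rwa [uIcc_of_le ht.1]
    have hweak := hw.weak _ hφ t (hsub ht)
    have e1 : ∫ x, timeDeriv T w t x * (χ t * expTest η ξ x)
        = ∫ x, timeDeriv T w t x * expTest η ξ x := by simp_rw [hχ1 t ht, one_mul]
    have e2 : ∫ s in (0 : ℝ)..t, ∫ x, (-(timeDeriv T w s x *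
          _root_.deriv (fun r => χ r * expTest η ξ x) s)
          + fderiv ℝ (fun y => χ s * expTest η ξ y) x (grad (w s) x))
        = -∫ s in (0 : ℝ)..t, ‖ξ‖ ^ 2 * ∫ x, fn (w s) x * expTest η ξ x := by
      rw [← intervalIntegral.integral_neg]
      refine intervalIntegral.integral_congr fun s hs' => ?_
      have hs1 := hsub'' hs'
      have hd : ∀ x, _root_.deriv (fun r => χ r * expTest η ξ x) s = 0 := by
        intro x
        have : (fun r => χ r * expTest η ξ x) =ᶠ[𝓝 s] fun _ => 1 * expTest η ξ x := by
          filter_upwards [hχ s hs1] with r hr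
          rw [hr]
        rw [this.deriv_eq, deriv_const]
      simp_rw [hd, hχ1 s hs1, one_mul, mul_zero, neg_zero, zero_add]
      exact integral_fderiv_expTest_grad (r := s + R) (by linarith [hs1.2]) (hs s (hsub hs1))
    have e3 : ∫ s in (0 : ℝ)..t, ∫ x, ν₁ / (1 + s) ^ β * timeDeriv T w s x
          * (χ s * expTest η ξ x)
        = ∫ s in (0 : ℝ)..t, ν₁ / (1 + s) ^ β * ∫ x, timeDeriv T w s x * expTest η ξ x := by
      refine intervalIntegral.integral_congr fun s hs' => ?_
      simp_rw [hχ1 s (hsub'' hs'), one_mul, mul_assoc]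
      exact integral_const_mul _ _
    have e4 : ∫ s in (0 : ℝ)..t, ∫ x, ν₂ / (1 + s) ^ 2 * fn (w s) x * (χ s * expTest η ξ x)
        = -∫ s in (0 : ℝ)..t, -ν₂ / (1 + s) ^ 2 * ∫ x, fn (w s) x * expTest η ξ x := by
      rw [← intervalIntegral.integral_neg]
      refine intervalIntegral.integral_congr fun s hs' => ?_
      simp_rw [hχ1 s (hsub'' hs'), one_mul, mul_assoc]
      rw [integral_const_mul]
      ring
    have e5 : ∫ x, ε * g x * (χ 0 * expTest η ξ x)
        = ∫ x, timeDeriv T w 0 x * expTest η ξ x := by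
      rw [hw.init_deriv]
      refine integral_congr_ae ?_
      filter_upwards [Lp.coeFn_smul ε g] with x hx
      rw [hx, hχ1 0 ⟨le_rfl, ht₁.le⟩, one_mul]
      rfl
    have e6 : ∫ s in (0 : ℝ)..t, ∫ x, |fn (w s) x| ^ p * (χ s * expTest η ξ x)
        = ∫ s in (0 : ℝ)..t, ∫ x, |fn (w s) x| ^ p * expTest η ξ x :=
      intervalIntegral.integral_congr fun s hs' => hNeq s (hsub'' hs')
    rw [e1, e2, e3, e4, e5, e6] at hweak
    have e7 : ∫ s in (0 : ℝ)..t, (‖ξ‖ ^ 2 + -ν₂ / (1 + s) ^ 2) * ∫ x, fn (w s) x * expTest η ξ x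
        = (∫ s in (0 : ℝ)..t, ‖ξ‖ ^ 2 * ∫ x, fn (w s) x * expTest η ξ x)
          + ∫ s in (0 : ℝ)..t, -ν₂ / (1 + s) ^ 2 * ∫ x, fn (w s) x * expTest η ξ x := by
      rw [← intervalIntegral.integral_add]
      · simp_rw [add_mul]
      · exact ((continuousOn_const.mul hcG).mono hsub'').intervalIntegrable
      · have := continuousOn_potential (a := -ν₂) (κ := 0) (b := t₁)
        simp only [ne_eq, OfNat.ofNat_ne_zero, not_false_eq_true, zero_pow, zero_add] at this
        exact ((this.mul hcG).mono hsub'').intervalIntegrable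
    rw [e7]
    linarith

end moments

/-! ### Lower bounds for the nonlinear term -/

section Holder

variable {n : ℕ} {p ρ : ℝ} {u : Space n → ℝ}

lemma memLp_mul_of_continuous {q : ℝ≥0∞}
    (hu : MemLp u q (volume.restrict (Metric.closedBall 0 ρ))) {v : Space n → ℝ}
    (hv : Continuous v) :
    MemLp (fun x => u x * v x) q (volume.restrict (Metric.closedBall 0 ρ)) := by
  obtain ⟨C, hC⟩ := (isCompact_closedBall (0 : Space n) ρ).exists_bound_of_continuousOn
    hv.continuousOn
  refine MemLp.of_le_mul (c := C) hu
    (hu.aestronglyMeasurable.mul hv.aestronglyMeasurable) ?_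
  filter_upwards [ae_restrict_mem Metric.isClosed_closedBall.measurableSet] with x hx
  rw [norm_mul, mul_comm]
  exact mul_le_mul_of_nonneg_right (hC x hx) (norm_nonneg _)

/-- Hölder with respect to the measure e^{x·ξ} dx on the ball. Frequency ξ = 0 gives the mass bound,
‖ξ‖ ≥ 1 the wave bound. -/
lemma rpow_integral_exp_le (hp : 1 < p)
    (hu : MemLp u (ENNReal.ofReal p) (volume.restrict (Metric.closedBall 0 ρ))) (ξ : Space n) :
    |∫ x in Metric.closedBall (0 : Space n) ρ, u x * Real.exp (inner ℝ x ξ)| ^ p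
      ≤ (∫ x in Metric.closedBall (0 : Space n) ρ, |u x| ^ p * Real.exp (inner ℝ x ξ))
        * (∫ x in Metric.closedBall (0 : Space n) ρ, Real.exp (inner ℝ x ξ)) ^ (p - 1) := by
  have hp0 : 0 < p := by linarith
  set q := p.conjExponent with hq
  have hpq : p.HolderConjugate q := Real.HolderConjugate.conjExponent hp
  have hq0 : 0 < q := hpq.symm.pos
  have hc : ∀ c : ℝ, Continuous fun x : Space n => Real.exp (c * inner ℝ x ξ) :=
    fun c => by fun_prop
  have hf : MemLp (fun x => |u x| * Real.exp (1 / p * inner ℝ x ξ)) (ENNReal.ofReal p)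
      (volume.restrict (Metric.closedBall 0 ρ)) := memLp_mul_of_continuous hu.abs (hc _)
  have hg : MemLp (fun x => Real.exp (1 / q * inner ℝ x ξ)) (ENNReal.ofReal q)
      (volume.restrict (Metric.closedBall 0 ρ)) := by
    have : IsFiniteMeasure (volume.restrict (Metric.closedBall (0 : Space n) ρ)) :=
      ⟨by simpa using measure_closedBall_lt_top⟩
    have : MemLp (fun _ : Space n => (1 : ℝ)) (ENNReal.ofReal q)
      (volume.restrict (Metric.closedBall 0 ρ)) := memLp_const 1
    simpa using memLp_mul_of_continuous this (hc (1 / q))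
  have h1 := integral_mul_le_Lp_mul_Lq_of_nonneg hpq
    (ae_of_all _ fun x => by positivity) (ae_of_all _ fun x => by positivity) hf hg
  have e1 : ∀ x : Space n, |u x| * Real.exp (1 / p * inner ℝ x ξ)
      * Real.exp (1 / q * inner ℝ x ξ) = |u x * Real.exp (inner ℝ x ξ)| := by
    intro x
    rw [mul_assoc, ← Real.exp_add, ← add_mul, one_div, one_div, hpq.inv_add_inv_eq_one, one_mul,
      abs_mul, abs_of_pos (Real.exp_pos _)]
  have e2 : ∀ x : Space n, (|u x| * Real.exp (1 / p * inner ℝ x ξ)) ^ p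
      = |u x| ^ p * Real.exp (inner ℝ x ξ) := by
    intro x
    rw [Real.mul_rpow (abs_nonneg _) (Real.exp_pos _).le, ← Real.exp_mul]
    congr 2
    field_simp
  have e3 : ∀ x : Space n, Real.exp (1 / q * inner ℝ x ξ) ^ q = Real.exp (inner ℝ x ξ) := by
    intro x
    rw [← Real.exp_mul]
    congr 1
    field_simp
  simp_rw [e1, e2, e3] at h1
  have hA : 0 ≤ ∫ x in Metric.closedBall (0 : Space n) ρ, |u x| ^ p * Real.exp (inner ℝ x ξ) :=
    integral_nonneg fun x => by positivity
  have hB : 0 ≤ ∫ x in Metric.closedBall (0 : Space n) ρ, Real.exp (inner ℝ x ξ) :=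
    integral_nonneg fun x => by positivity
  calc _ ≤ (∫ x in Metric.closedBall (0 : Space n) ρ, |u x * Real.exp (inner ℝ x ξ)|) ^ p :=
        Real.rpow_le_rpow (abs_nonneg _) abs_integral_le_integral_abs hp0.le
    _ ≤ _ := Real.rpow_le_rpow (integral_nonneg fun x => abs_nonneg _) h1 hp0.le
    _ = _ := by
      rw [Real.mul_rpow (by positivity) (by positivity), ← Real.rpow_mul hA, ← Real.rpow_mul hB,
        one_div_mul_cancel hp0.ne', Real.rpow_one]
      congr 2
      have h2 : 1 / q = 1 - p⁻¹ := by rw [one_div]; linarith [hpq.inv_add_inv_eq_one]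
      rw [h2, sub_mul, inv_mul_cancel₀ hp0.ne', one_mul]

lemma integrableOn_abs_rpow_mul_exp (hp : 1 < p)
    (hu : MemLp u (ENNReal.ofReal p) (volume.restrict (Metric.closedBall 0 ρ))) (ξ : Space n)
    (c : ℝ) :
    IntegrableOn (fun x => |u x| ^ p * Real.exp (inner ℝ x ξ - c)) (Metric.closedBall 0 ρ) := by
  have hp0 : 0 < p := by linarith
  have h := hu.integrable_norm_rpow (by simpa using hp0) ENNReal.ofReal_ne_top
  rw [ENNReal.toReal_ofReal hp0.le, ← memLp_one_iff_integrable] at h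
  exact memLp_one_iff_integrable.1 (memLp_mul_of_continuous h
    (by fun_prop : Continuous fun x : Space n => Real.exp (inner ℝ x ξ - c)))

/-- Exponential moments in a set of frequencies control the `L^p` norm on a ball from below. -/
lemma le_integral_abs_rpow_of_exp (hn : 1 ≤ n) (hp : 1 < p) {D : Set (Space n)}
    (hDm : MeasurableSet D) (hD1 : ∀ ξ ∈ D, 1 ≤ ‖ξ‖) (hD2 : ∀ ξ ∈ D, ‖ξ‖ ≤ 2)
    (hD0 : volume D ≠ 0) (hDtop : volume D ≠ ⊤) :
    ∃ c : ℝ, 0 < c ∧ ∀ ρ : ℝ, 0 < ρ → ∀ u : Space n → ℝ, Measurable u →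
      MemLp u (ENNReal.ofReal p) (volume.restrict (Metric.closedBall 0 ρ)) →
      ∀ K : ℝ, 0 ≤ K → (∀ ξ ∈ D, K * Real.exp (‖ξ‖ * ρ)
        ≤ ∫ x in Metric.closedBall (0 : Space n) ρ, u x * Real.exp (inner ℝ x ξ)) →
      c * K ^ p * ρ ^ (((n : ℝ) - 1) / 2 * (2 - p))
        ≤ ∫ x in Metric.closedBall (0 : Space n) ρ, |u x| ^ p := by
  have hp0 : 0 < p := by linarith
  set m := ((n : ℝ) - 1) / 2 with hm
  set C₁ := 2 * √(4 * Real.pi) ^ (n - 1) with hC₁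
  set C₂ := 4 * √(4 * Real.pi) ^ (n - 1) with hC₂
  have hC₁0 : 0 < C₁ := by positivity
  have hC₂0 : 0 < C₂ := by positivity
  set d := (volume D).toReal with hd
  have hd0 : 0 < d := ENNReal.toReal_pos hD0 hDtop
  refine ⟨d / C₂ * C₁ ^ (-(p - 1)), by positivity, fun ρ hρ u hum hu K hK hG => ?_⟩
  set B := Metric.closedBall (0 : Space n) ρ with hB
  set J : Space n → ℝ := fun ξ => ∫ x in B, |u x| ^ p * Real.exp (inner ℝ x ξ - ‖ξ‖ * ρ) with hJ
  set S := ∫ x in B, |u x| ^ p with hS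
  set L := K ^ p * (C₁ * ρ ^ m) ^ (-(p - 1)) with hL
  have hL0 : 0 ≤ L := by positivity
  -- After normalisation by e^{-‖ξ‖ρ} all exponential factors cancel in Hölder's inequality.
  have hLJ : ∀ ξ ∈ D, L ≤ J ξ := by
    intro ξ hξ
    have h1 := rpow_integral_exp_le hp hu ξ
    have h2 := integral_exp_ball_le hn hρ (hD1 ξ hξ)
    have e1 : ∫ x in B, Real.exp (inner ℝ x ξ)
        = Real.exp (‖ξ‖ * ρ) * ∫ x in B, Real.exp (inner ℝ x ξ - ‖ξ‖ * ρ) := by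
      rw [← integral_const_mul]
      simp_rw [← Real.exp_add]
      congr 2
      ext x
      ring_nf
    have e2 : ∫ x in B, |u x| ^ p * Real.exp (inner ℝ x ξ) = Real.exp (‖ξ‖ * ρ) * J ξ := by
      rw [hJ, ← integral_const_mul]
      congr 1
      ext x
      rw [mul_left_comm, ← Real.exp_add]
      ring_nf
    have hJ0 : 0 ≤ J ξ := integral_nonneg fun x => by positivity
    have hI0 : 0 ≤ ∫ x in B, Real.exp (inner ℝ x ξ - ‖ξ‖ * ρ) :=
      integral_nonneg fun x => by positivity
    have h3 : (K * Real.exp (‖ξ‖ * ρ)) ^ p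
        ≤ |∫ x in B, u x * Real.exp (inner ℝ x ξ)| ^ p :=
      Real.rpow_le_rpow (by positivity) ((hG ξ hξ).trans (le_abs_self _)) hp0.le
    have h4 : (∫ x in B, Real.exp (inner ℝ x ξ - ‖ξ‖ * ρ)) ^ (p - 1) ≤ (C₁ * ρ ^ m) ^ (p - 1) :=
      Real.rpow_le_rpow hI0 h2 (by linarith)
    have h5 := h3.trans h1
    rw [e1, e2, Real.mul_rpow hK (Real.exp_pos _).le,
      Real.mul_rpow (Real.exp_pos _).le hI0] at h5
    set X := Real.exp (‖ξ‖ * ρ) with hX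
    have hX0 : 0 < X := Real.exp_pos _
    have hXp : X ^ p = X * X ^ (p - 1) := by
      rw [mul_comm, ← Real.rpow_add_one hX0.ne', sub_add_cancel]
    have h6 : X ^ p * K ^ p ≤ X ^ p * (J ξ * (C₁ * ρ ^ m) ^ (p - 1)) := by
      calc X ^ p * K ^ p = K ^ p * X ^ p := mul_comm _ _
        _ ≤ _ := h5
        _ = X ^ p * (J ξ * (∫ x in B, Real.exp (inner ℝ x ξ - ‖ξ‖ * ρ)) ^ (p - 1)) := by
          rw [hXp]; ring
        _ ≤ _ := by gcongr
    have h7 := le_of_mul_le_mul_left h6 (by positivity)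
    rw [hL, Real.rpow_neg (by positivity), ← div_eq_mul_inv, div_le_iff₀ (by positivity)]
    exact h7
  -- Integrate over D and exchange the integrals. The superposed exponentials are of size ρ^{-m}
  -- uniformly on the ball, a gain that no single frequency provides.
  have hI : ENNReal.ofReal (L * d) ≤ ENNReal.ofReal (C₂ * ρ ^ (-m) * S) := by
    have hmeas : Measurable (Function.uncurry fun (ξ x : Space n) =>
        ENNReal.ofReal (|u x| ^ p) * ENNReal.ofReal (Real.exp (inner ℝ x ξ - ‖ξ‖ * ρ))) := by
      have h1 : Measurable fun z : Space n × Space n => u z.2 := hum.comp measurable_snd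
      have h2 : Continuous fun z : Space n × Space n =>
        Real.exp (inner ℝ z.2 z.1 - ‖z.1‖ * ρ) := by fun_prop
      have h3 : Measurable fun z : Space n × Space n => |u z.2| ^ p :=
        (continuous_abs.measurable.comp h1).pow_const p
      exact h3.ennreal_ofReal.mul h2.measurable.ennreal_ofReal
    calc ENNReal.ofReal (L * d) = ENNReal.ofReal L * volume D := by
          rw [ENNReal.ofReal_mul hL0, hd, ENNReal.ofReal_toReal hDtop]
      _ = ∫⁻ _ in D, ENNReal.ofReal L := by rw [setLIntegral_const]
      _ ≤ ∫⁻ ξ in D, ∫⁻ x in B, ENNReal.ofReal (|u x| ^ p)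
            * ENNReal.ofReal (Real.exp (inner ℝ x ξ - ‖ξ‖ * ρ)) := by
          refine setLIntegral_mono' hDm fun ξ hξ => ?_
          refine (ENNReal.ofReal_le_ofReal (hLJ ξ hξ)).trans ?_
          rw [hJ, ofReal_integral_eq_lintegral_ofReal (integrableOn_abs_rpow_mul_exp hp hu ξ _)
            (ae_of_all _ fun x => by positivity)]
          exact (lintegral_congr fun x => ENNReal.ofReal_mul (by positivity)).le
      _ = ∫⁻ x in B, ∫⁻ ξ in D, ENNReal.ofReal (|u x| ^ p)
            * ENNReal.ofReal (Real.exp (inner ℝ x ξ - ‖ξ‖ * ρ)) :=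
          lintegral_lintegral_swap hmeas.aemeasurable
      _ ≤ ∫⁻ x in B, ENNReal.ofReal (|u x| ^ p) * ENNReal.ofReal (C₂ * ρ ^ (-m)) := by
          refine setLIntegral_mono' Metric.isClosed_closedBall.measurableSet fun x hx => ?_
          rw [lintegral_const_mul' _ _ ENNReal.ofReal_ne_top]
          gcongr
          exact lintegral_frequency_le hn hρ (mem_closedBall_zero_iff.1 hx) hDm hD2
      _ = _ := by
          have hSint : IntegrableOn (fun x => |u x| ^ p) B := by
            simpa using integrableOn_abs_rpow_mul_exp hp hu 0 0
          rw [lintegral_mul_const' _ _ ENNReal.ofReal_ne_top, mul_comm,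
            ENNReal.ofReal_mul (p := C₂ * ρ ^ (-m)) (by positivity), hS,
            ofReal_integral_eq_lintegral_ofReal hSint (ae_of_all _ fun x => by positivity)]
  have hS0 : 0 ≤ S := integral_nonneg fun x => by positivity
  have h1 : L * d ≤ C₂ * ρ ^ (-m) * S := (ENNReal.ofReal_le_ofReal_iff (by positivity)).1 hI
  have e1 : ρ ^ (m * (2 - p)) = ρ ^ m * (ρ ^ m) ^ (-(p - 1)) := by
    rw [← Real.rpow_mul hρ.le, ← Real.rpow_add hρ]
    ring_nf
  have e2 : ρ ^ m * ρ ^ (-m) = 1 := by rw [← Real.rpow_add hρ]; simp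
  rw [e1]
  calc d / C₂ * C₁ ^ (-(p - 1)) * K ^ p * (ρ ^ m * (ρ ^ m) ^ (-(p - 1)))
      = ρ ^ m / C₂ * (L * d) := by
        rw [hL, Real.mul_rpow hC₁0.le (by positivity)]; ring
    _ ≤ ρ ^ m / C₂ * (C₂ * ρ ^ (-m) * S) := by gcongr
    _ = (ρ ^ m * ρ ^ (-m)) * S := by field_simp
    _ = S := by rw [e2, one_mul]

/-- The `L^p` norm on a ball controls the mass. -/
lemma le_integral_abs_rpow_of_mass (hp : 1 < p) :
    ∃ c : ℝ, 0 < c ∧ ∀ ρ : ℝ, 0 < ρ → ∀ u : Space n → ℝ,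
      MemLp u (ENNReal.ofReal p) (volume.restrict (Metric.closedBall 0 ρ)) →
      c * ρ ^ (-((n : ℝ) * (p - 1))) * |∫ x in Metric.closedBall (0 : Space n) ρ, u x| ^ p
        ≤ ∫ x in Metric.closedBall (0 : Space n) ρ, |u x| ^ p := by
  set v := volume.real (Metric.ball (0 : Space n) 1) with hv
  have hv0 : 0 < v := ENNReal.toReal_pos (Metric.measure_ball_pos _ _ one_pos).ne'
    measure_ball_lt_top.ne
  refine ⟨v ^ (-(p - 1)), by positivity, fun ρ hρ u hu => ?_⟩
  have h1 := rpow_integral_exp_le hp hu 0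
  have hvol : volume.real (Metric.closedBall (0 : Space n) ρ) = ρ ^ (n : ℝ) * v := by
    rw [measureReal_def, Measure.addHaar_closedBall _ _ hρ.le, ENNReal.toReal_mul,
      ENNReal.toReal_ofReal (by positivity), hv, measureReal_def]
    simp
  simp only [inner_zero_right, Real.exp_zero, mul_one, integral_const, smul_eq_mul,
    measureReal_restrict_apply_univ, hvol] at h1
  rw [Real.mul_rpow (by positivity) hv0.le, ← Real.rpow_mul hρ.le] at h1
  rw [Real.rpow_neg hv0.le, Real.rpow_neg hρ.le, ← mul_inv, inv_mul_le_iff₀ (by positivity)]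
  linarith

end Holder

lemma exists_frequencies {n : ℕ} (hn : 1 ≤ n) : ∃ D : Set (Space n), MeasurableSet D ∧
    (∀ ξ ∈ D, 1 ≤ ‖ξ‖) ∧ (∀ ξ ∈ D, ‖ξ‖ ≤ 2) ∧ volume D ≠ 0 ∧ volume D ≠ ⊤ := by
  set e : Space n := EuclideanSpace.single ⟨0, hn⟩ (3 / 2) with he
  have hne : ‖e‖ = 3 / 2 := by simp [he]
  refine ⟨Metric.closedBall e (1 / 2), Metric.isClosed_closedBall.measurableSet, ?_, ?_,
    (Metric.measure_closedBall_pos _ _ (by norm_num)).ne', measure_closedBall_lt_top.ne⟩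
  · intro ξ hξ
    rw [mem_closedBall_iff_norm] at hξ
    have := norm_sub_norm_le e ξ
    rw [norm_sub_rev] at this
    linarith
  · intro ξ hξ
    rw [mem_closedBall_iff_norm] at hξ
    have := norm_sub_norm_le ξ e
    linarith

/-- Two-sided control of x is needed because the exponent (n−1)(2−p)/2 can have either sign. -/
lemma min_rpow_mul_le {x y a b e : ℝ} (hy : 0 < y) (ha : 0 < a) (hax : a * y ≤ x)
    (hxb : x ≤ b * y) : min (a ^ e) (b ^ e) * y ^ e ≤ x ^ e := by
  have hay : 0 < a * y := by positivity
  have hx : 0 < x := hay.trans_le hax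
  have hb : 0 < b := (mul_pos_iff_of_pos_right hy).1 (hx.trans_le hxb)
  rcases le_or_gt 0 e with he | he
  · calc _ ≤ a ^ e * y ^ e := by gcongr; exact min_le_left _ _
      _ = (a * y) ^ e := (Real.mul_rpow ha.le hy.le).symm
      _ ≤ _ := Real.rpow_le_rpow hay.le hax he
  · calc _ ≤ b ^ e * y ^ e := by gcongr; exact min_le_right _ _
      _ = (b * y) ^ e := (Real.mul_rpow hb.le hy.le).symm
      _ ≤ _ := Real.rpow_le_rpow_of_nonpos hx hxb he.le

/-! ### Initial data -/

/-- The weak gradient is determined by the function, by the fundamental lemma of the calculus of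
variations. -/
lemma eq_zero_of_fn_eq_zero {n : ℕ} {f : H1 n} (hf : fn f = 0) : f = 0 := by
  have hu : ∀ᵐ x, fn f x = 0 := by
    rw [hf]
    exact Lp.coeFn_zero ℝ 2 volume
  have hG : ∀ e : Space n, ∀ᵐ x, inner ℝ (grad f x) e = 0 := by
    intro e
    refine ae_eq_zero_of_integral_contDiff_smul_eq_zero
      (((Lp.memLp (grad f)).inner_const e).locallyIntegrable (by norm_num)) fun φ hφ hc => ?_
    have h1 := f.2 φ hφ hc e
    have h2 : ∫ x, fn f x * fderiv ℝ φ x e = 0 := by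
      rw [integral_congr_ae (g := fun _ => (0 : ℝ))]
      · simp
      · filter_upwards [hu] with x hx
        rw [hx, zero_mul]
    have h3 : ∫ x, inner ℝ (grad f x) e * φ x = 0 := neg_eq_zero.1 (h1.symm.trans h2)
    simpa [mul_comm] using h3
  have h0 : grad f = 0 := by
    rw [Lp.eq_zero_iff_ae_eq_zero]
    filter_upwards [ae_all_iff.2 fun i => hG (EuclideanSpace.basisFun (Fin n) ℝ i)] with x hx
    ext i
    simpa [EuclideanSpace.inner_single_right] using hx i
  exact Subtype.ext (Prod.ext hf h0)

lemma exists_radius {n : ℕ} {f : H1 n} {g : L2 n} (hf : 0 ≤ fn f) (hg : 0 ≤ g)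
    (hfg : f ≠ 0 ∨ g ≠ 0) :
    ∃ r : ℝ, 0 < r ∧ 0 < ∫ x in Metric.closedBall (0 : Space n) r, (fn f + g) x := by
  by_contra! hcon
  have hfg0 : 0 ≤ᵐ[volume] (fn f + g : L2 n) := (Lp.coeFn_nonneg _).2 (add_nonneg hf hg)
  have hball : ∀ k : ℕ, ∀ᵐ x ∂volume.restrict (Metric.closedBall (0 : Space n) (k + 1)),
      (fn f + g) x = 0 := by
    intro k
    have h1 := hcon (k + 1) (by positivity)
    have hint : IntegrableOn (fn f + g : L2 n) (Metric.closedBall (0 : Space n) (k + 1)) :=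
      ((Lp.memLp (fn f + g)).locallyIntegrable (by norm_num)).integrableOn_isCompact
        (isCompact_closedBall _ _)
    exact (setIntegral_eq_zero_iff_of_nonneg_ae (ae_restrict_of_ae hfg0) hint).1
      (le_antisymm h1 (setIntegral_nonneg_of_ae hfg0))
  have hall : ∀ᵐ x, (fn f + g) x = 0 := by
    have h2 : ∀ᵐ x, ∀ k : ℕ, x ∈ Metric.closedBall (0 : Space n) (k + 1) → (fn f + g) x = 0 :=
      ae_all_iff.2 fun k => (ae_restrict_iff' Metric.isClosed_closedBall.measurableSet).1 (hball k)
    filter_upwards [h2] with x hx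
    obtain ⟨k, hk⟩ := exists_nat_ge ‖x‖
    exact hx k (by simpa using hk.trans (by linarith))
  have hzero : fn f + g = 0 := (Lp.eq_zero_iff_ae_eq_zero).2 hall
  have h3 := (add_eq_zero_iff_of_nonneg hf hg).1 hzero
  rcases hfg with h | h
  · exact h (eq_zero_of_fn_eq_zero h3.1)
  · exact h h3.2

lemma integral_mul_expTest_nonneg {n : ℕ} {u : L2 n} (hu : 0 ≤ u)
    (η : ContDiffBump (0 : Space n)) (ξ : Space n) : 0 ≤ ∫ x, u x * expTest η ξ x := by
  refine integral_nonneg_of_ae ?_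
  filter_upwards [(Lp.coeFn_nonneg u).2 hu] with x hx
  exact mul_nonneg hx (expTest_nonneg η ξ x)

/-- The lower bound for the initial moments is uniform in the frequency and in the cut-off. This
keeps the final constants independent of the time horizon. -/
lemma exp_mul_integral_le {n : ℕ} {f g : L2 n} (hf : 0 ≤ f) (hg : 0 ≤ g) {r : ℝ}
    {η : ContDiffBump (0 : Space n)} (hr : r ≤ η.rIn) {ξ : Space n} (hξ : ‖ξ‖ ≤ 2) :
    Real.exp (-(2 * r)) * ∫ x in Metric.closedBall (0 : Space n) r, (f + g) x
      ≤ (∫ x, g x * expTest η ξ x) + ∫ x, f x * expTest η ξ x := by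
  have hi := fun u : L2 n =>
    integrable_mul_test u (continuous_expTest η ξ) (hasCompactSupport_expTest η ξ)
  have hfg0 : 0 ≤ᵐ[volume] (f + g : L2 n) := (Lp.coeFn_nonneg _).2 (add_nonneg hf hg)
  have e1 : (∫ x, g x * expTest η ξ x) + ∫ x, f x * expTest η ξ x
      = ∫ x, (f + g) x * expTest η ξ x := by
    rw [← integral_add (hi g) (hi f)]
    refine integral_congr_ae ?_
    filter_upwards [Lp.coeFn_add f g] with x hx
    rw [hx, Pi.add_apply]
    ring
  rw [e1, ← integral_const_mul]
  have hint : IntegrableOn (f + g : L2 n) (Metric.closedBall (0 : Space n) r) :=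
    ((Lp.memLp (f + g)).locallyIntegrable (by norm_num)).integrableOn_isCompact
      (isCompact_closedBall _ _)
  refine le_trans (setIntegral_mono_on_ae (hint.const_mul _) (hi (f + g)).integrableOn
    Metric.isClosed_closedBall.measurableSet (g := fun x => (f + g) x * expTest η ξ x) ?_)
    (setIntegral_le_integral (hi (f + g)) ?_)
  · filter_upwards [hfg0] with x hx hxr
    rw [mem_closedBall_zero_iff] at hxr
    rw [mul_comm, expTest_eq (hxr.trans hr)]
    refine mul_le_mul_of_nonneg_left (Real.exp_le_exp.2 ?_) hx
    have h1 := neg_le_of_abs_le (abs_real_inner_le_norm x ξ)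
    have h2 : ‖x‖ * ‖ξ‖ ≤ r * 2 :=
      mul_le_mul hxr hξ (norm_nonneg _) ((norm_nonneg _).trans hxr)
    linarith
  · filter_upwards [hfg0] with x hx
    exact mul_nonneg hx (expTest_nonneg η ξ x)

lemma integral_mul_expTest_eq {n : ℕ} {η : ContDiffBump (0 : Space n)} (ξ : Space n) {r : ℝ}
    (hr : r ≤ η.rIn) {v : Space n → ℝ} (hv : ∀ᵐ x, r < ‖x‖ → v x = 0) :
    ∫ x, v x * expTest η ξ x
      = ∫ x in Metric.closedBall (0 : Space n) r, v x * Real.exp (inner ℝ x ξ) := by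
  rw [← setIntegral_eq_integral_of_ae_compl_eq_zero (s := Metric.closedBall (0 : Space n) r)]
  · refine setIntegral_congr_fun Metric.isClosed_closedBall.measurableSet fun x hx => ?_
    rw [mem_closedBall_zero_iff] at hx
    simp only [expTest_eq (hx.trans hr)]
  · filter_upwards [hv] with x hx hxr
    rw [mem_closedBall_zero_iff, not_le] at hxr
    rw [hx hxr, zero_mul]

/-! ### Bounds for energy solutions -/

section solution

variable {n : ℕ} {ν₁ ν₂ β p ε R : ℝ} {f : H1 n} {g : L2 n} {T : ℝ≥0∞} {w : ℝ → H1 n}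

lemma moment_init (hw : IsEnergySolution ν₁ ν₂ β p ε f g T w)
    (η : ContDiffBump (0 : Space n)) (ξ : Space n) :
    ∫ x, fn (w 0) x * expTest η ξ x = ε * ∫ x, fn f x * expTest η ξ x := by
  rw [hw.init, ← integral_const_mul]
  refine integral_congr_ae ?_
  filter_upwards [Lp.coeFn_smul ε (fn f)] with x hx
  rw [← mul_assoc, ← smul_eq_mul ε, ← Pi.smul_apply, ← hx]
  rfl

lemma moment_init_deriv (hw : IsEnergySolution ν₁ ν₂ β p ε f g T w)
    (η : ContDiffBump (0 : Space n)) (ξ : Space n) :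
    ∫ x, timeDeriv T w 0 x * expTest η ξ x = ε * ∫ x, g x * expTest η ξ x := by
  rw [hw.init_deriv, ← integral_const_mul]
  refine integral_congr_ae ?_
  filter_upwards [Lp.coeFn_smul ε g] with x hx
  rw [hx, Pi.smul_apply, smul_eq_mul, mul_assoc]

lemma integral_abs_rpow_expTest_zero (hp : 1 < p) {η : ContDiffBump (0 : Space n)} {t : ℝ}
    (hη : t + R ≤ η.rIn) {u : Space n → ℝ} (hu : ∀ᵐ x, t + R < ‖x‖ → u x = 0) :
    ∫ x, |u x| ^ p * expTest η 0 x = ∫ x in Metric.closedBall (0 : Space n) (t + R), |u x| ^ p := by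
  rw [integral_mul_expTest_eq 0 hη]
  · simp
  · filter_upwards [hu] with x hx hxr
    rw [hx hxr, abs_zero, Real.zero_rpow (by linarith)]

/-- Lower bound of the nonlinear term by the mass. -/
lemma exists_mass_bound (n : ℕ) {p R : ℝ} (hp : 1 < p) (hR : 1 ≤ R) :
    ∃ c : ℝ, 0 < c ∧ ∀ (ν₁ ν₂ β ε : ℝ) (f : H1 n) (g : L2 n) (T : ℝ≥0∞) (w : ℝ → H1 n),
      IsEnergySolution ν₁ ν₂ β p ε f g T w → SupportedInCone R T w →
      ∀ (η : ContDiffBump (0 : Space n)) (t : ℝ), 0 < t → t ∈ timeInterval T → t + R ≤ η.rIn →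
      c * (1 + t) ^ (-((n : ℝ) * (p - 1))) * |∫ x, fn (w t) x * expTest η 0 x| ^ p
        ≤ ∫ x, |fn (w t) x| ^ p * expTest η 0 x := by
  obtain ⟨c, hc, h⟩ := le_integral_abs_rpow_of_mass (n := n) hp
  refine ⟨c * R ^ (-((n : ℝ) * (p - 1))), by positivity,
    fun ν₁ ν₂ β ε f g T w hw hs η t ht htT hη => ?_⟩
  have hsupp := hs t htT
  have hm := hw.memLp_loc t htT ht _ (isCompact_closedBall (0 : Space n) (t + R))
  have h1 := h (t + R) (by linarith) _ hm
  rw [integral_abs_rpow_expTest_zero hp hη hsupp, integral_mul_expTest_eq 0 hη hsupp]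
  simp only [inner_zero_right, Real.exp_zero, mul_one]
  refine le_trans ?_ h1
  refine mul_le_mul_of_nonneg_right ?_ (by positivity)
  rw [mul_assoc, ← Real.mul_rpow (by linarith) (by linarith)]
  refine mul_le_mul_of_nonneg_left ?_ hc.le
  refine Real.rpow_le_rpow_of_nonpos (by linarith) (by nlinarith) ?_
  have : 0 ≤ (n : ℝ) * (p - 1) := mul_nonneg (by positivity) (by linarith)
  linarith

/-- Lower bound of the nonlinear term by the exponential moments of the data. -/
lemma exists_wave_bound (hn : 1 ≤ n) (hp : 1 < p) (hR : 1 ≤ R) (hν₁ : 0 ≤ ν₁) (hν₂ : ν₂ < 0)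
    (hβ : 1 < β) (hf : 0 ≤ fn f) (hg : 0 ≤ g) {r : ℝ}
    (hr : 0 < ∫ x in Metric.closedBall (0 : Space n) r, (fn f + g) x) :
    ∃ c : ℝ, 0 < c ∧ ∀ (ε : ℝ) (T : ℝ≥0∞) (w : ℝ → H1 n), 0 < ε →
      IsEnergySolution ν₁ ν₂ β p ε f g T w → SupportedInCone R T w →
      ∀ (t₁ : ℝ), ENNReal.ofReal t₁ < T →
      ∀ (η : ContDiffBump (0 : Space n)), t₁ + R < η.rIn → r ≤ η.rIn → ∀ t ∈ Icc 1 t₁,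
      c * ε ^ p * t ^ (((n : ℝ) - 1) / 2 * (2 - p))
        ≤ ∫ x, |fn (w t) x| ^ p * expTest η 0 x := by
  obtain ⟨D, hDm, hD1, hD2, hD0, hDtop⟩ := exists_frequencies hn
  obtain ⟨c₁, hc₁, hD⟩ := le_integral_abs_rpow_of_exp hn hp hDm hD1 hD2 hD0 hDtop
  set e := ((n : ℝ) - 1) / 2 * (2 - p) with he
  set I := ∫ x in Metric.closedBall (0 : Space n) r, (fn f + g) x with hI
  set m₀ := damp ν₁ β 0 with hm₀
  have hm₀0 : 0 < m₀ := damp_pos _ _ _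
  -- The last factor compares e^{‖ξ‖(t+R)} with e^{‖ξ‖t} for ‖ξ‖ ≤ 2.
  set c₂ := m₀ * (Real.exp (-(2 * r)) * I) / 8 * Real.exp (-(2 * R)) with hc₂
  have hc₂0 : 0 < c₂ := by positivity
  have hR0 : 0 < 1 + R := by linarith
  refine ⟨c₁ * c₂ ^ p * min (1 ^ e) ((1 + R) ^ e), by positivity,
    fun ε T w hε hw hs t₁ hT η hη hrη t ht => ?_⟩
  have ht₁ : 0 < t₁ := by linarith [ht.1, ht.2]
  have ht0 : 0 < t := by linarith [ht.1]
  have htT : t ∈ timeInterval T := Icc_subset_timeInterval hT ⟨ht0.le, ht.2⟩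
  have htη : t + R ≤ η.rIn := by linarith [ht.2]
  have hsupp := hs t htT
  have hm := hw.memLp_loc t htT ht0 _ (isCompact_closedBall (0 : Space n) (t + R))
  rw [integral_abs_rpow_expTest_zero hp htη hsupp]
  have key := hD (t + R) (by linarith) _ (Lp.stronglyMeasurable (fn (w t))).measurable hm
    (c₂ * ε) (by positivity) fun ξ hξ => ?_
  · refine le_trans ?_ key
    have h1 := min_rpow_mul_le (x := t + R) (y := t) (a := 1) (b := 1 + R) (e := e) ht0 one_pos
      (by linarith) (by nlinarith [ht.1])
    calc _ = c₁ * (c₂ * ε) ^ p * (min (1 ^ e) ((1 + R) ^ e) * t ^ e) := by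
          rw [Real.mul_rpow hc₂0.le hε.le]; ring
      _ ≤ _ := by gcongr
  · rw [← integral_mul_expTest_eq ξ htη hsupp]
    have hmom := isMoment_of_isEnergySolution hw hs ht₁ hT hη ξ
    have hG0 := integral_mul_expTest_nonneg hf η ξ
    have hH0 := integral_mul_expTest_nonneg hg η ξ
    have h1 := hmom.exp_le_of_wave hν₁ hβ (by linarith)
      (by rw [moment_init hw]; positivity) (by rw [moment_init_deriv hw]; positivity)
      (hD1 ξ hξ) (hD2 ξ hξ) ht
    refine le_trans ?_ h1
    rw [moment_init hw, moment_init_deriv hw, ← mul_add]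
    have h2 := exp_mul_integral_le hf hg hrη (hD2 ξ hξ)
    have h3 : Real.exp (-(2 * R)) * Real.exp (‖ξ‖ * (t + R)) ≤ Real.exp (‖ξ‖ * t) := by
      rw [← Real.exp_add]
      refine Real.exp_le_exp.2 ?_
      nlinarith [hD2 ξ hξ]
    calc c₂ * ε * Real.exp (‖ξ‖ * (t + R))
        = m₀ * (ε * (Real.exp (-(2 * r)) * I)) / 8 *
          (Real.exp (-(2 * R)) * Real.exp (‖ξ‖ * (t + R))) := by rw [hc₂]; ring
      _ ≤ _ := by gcongr

/-- If the mass of every solution grows like `ε ^ θ * t ^ a`, then the lifespan is bounded by the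
time at which this growth becomes supercritical for the nonlinearity. -/
lemma exists_lifespan_le (hp : 1 < p) (hR : 1 ≤ R) (hν₁ : 0 ≤ ν₁) (hν₂ : ν₂ < 0)
    (hβ : 1 < β) (hf : 0 ≤ fn f) (hg : 0 ≤ g) (r : ℝ) {c θ a : ℝ} (hc : 0 < c) (hθ : 0 ≤ θ)
    (hΓ : 0 < 2 - n * (p - 1) + a * (p - 1))
    (hgrow : ∀ (ε : ℝ) (T : ℝ≥0∞) (w : ℝ → H1 n), 0 < ε →
      IsEnergySolution ν₁ ν₂ β p ε f g T w → SupportedInCone R T w →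
      ∀ (t₁ : ℝ), ENNReal.ofReal t₁ < T →
      ∀ (η : ContDiffBump (0 : Space n)), t₁ + R < η.rIn → r ≤ η.rIn → ∀ t ∈ Icc 2 t₁,
      c * ε ^ θ * t ^ a ≤ ∫ x, fn (w t) x * expTest η 0 x) :
    ∃ C : ℝ, 0 < C ∧ ∀ ε : ℝ, 0 < ε → ε ≤ 1 → lifespan ν₁ ν₂ β p R ε f g
      ≤ ENNReal.ofReal (C * ε ^ (-(θ * (p - 1) / (2 - n * (p - 1) + a * (p - 1))))) := by
  obtain ⟨c₁, hc₁, hmass⟩ := exists_mass_bound n hp hR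
  set Γ := 2 - n * (p - 1) + a * (p - 1) with hΓdef
  set b := (n : ℝ) * (p - 1) with hb
  have hb0 : 0 ≤ b := mul_nonneg (by positivity) (by linarith)
  set m₀ := damp ν₁ β 0 with hm₀
  have hm₀0 : 0 < m₀ := damp_pos _ _ _
  set c₂ := m₀ * c₁ / 4 with hc₂
  have hc₂0 : 0 < c₂ := by positivity
  set K := 2 * (4 * 4 ^ (1 / (p - 1)) / (c₂ * 4 ^ (-b))) ^ (1 / Γ) * c ^ (-((p - 1) / Γ)) with hK
  have hK0 : 0 < K := by positivity
  refine ⟨4 + K, by positivity, fun ε hε hε1 => sSup_le ?_⟩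
  rintro T ⟨w, hw, hs⟩
  by_contra! hlt
  obtain ⟨t₁, ht₁0, hlt₁, hT⟩ := ENNReal.lt_iff_exists_real_btwn.1 hlt
  set E := ε ^ (-(θ * (p - 1) / Γ)) with hE
  -- Here ε ≤ 1 is used: with E ≥ 1, the summand 4 in the constant guarantees t₁ > 4.
  have hE1 : 1 ≤ E := by
    refine Real.one_le_rpow_of_pos_of_le_one_of_nonpos hε hε1 ?_
    have : 0 ≤ θ * (p - 1) / Γ := div_nonneg (mul_nonneg hθ (by linarith)) hΓ.le
    linarith
  have hlt2 : (4 + K) * E < t₁ :=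
    (ENNReal.ofReal_lt_ofReal_iff_of_nonneg (by positivity)).1 hlt₁
  have ht₁ : 4 < t₁ := by nlinarith
  have hpos : 0 < t₁ + R + |r| + 1 := by linarith [abs_nonneg r]
  let η : ContDiffBump (0 : Space n) :=
    ⟨t₁ + R + |r| + 1, t₁ + R + |r| + 2, hpos, by linarith⟩
  have hη : t₁ + R < η.rIn := by
    change t₁ + R < t₁ + R + |r| + 1
    linarith [abs_nonneg r]
  have hηr : r ≤ η.rIn := by
    change r ≤ t₁ + R + |r| + 1
    linarith [le_abs_self r]
  have hmom := isMoment_of_isEnergySolution hw hs (by linarith) hT hη 0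
  have ha : 0 ≤ -ν₂ := by linarith
  have hG0 : 0 ≤ ∫ x, fn (w 0) x * expTest η 0 x := by
    rw [moment_init hw]
    exact mul_nonneg hε.le (integral_mul_expTest_nonneg hf η 0)
  have hH0 : 0 ≤ ∫ x, timeDeriv T w 0 x * expTest η 0 x := by
    rw [moment_init_deriv hw]
    exact mul_nonneg hε.le (integral_mul_expTest_nonneg hg η 0)
  have hmono := hmom.monotoneOn_G hν₁ hβ ha hG0 hH0
  have hbound := time_le_of_superlinear (b := b) (B := c * ε ^ θ) hc₂0 hb0 hp (by positivity) hΓ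
    ht₁ hmono ?_ (hgrow ε T w hε hw hs t₁ hT η hη hηr)
  · rw [Real.mul_rpow hc.le (by positivity), ← Real.rpow_mul hε.le] at hbound
    have e1 : θ * -((p - 1) / Γ) = -(θ * (p - 1) / Γ) := by ring
    rw [← hΓdef, e1, ← mul_assoc, ← hK, ← hE] at hbound
    nlinarith
  -- On [t, t+h] the mass is at least F t and the weight at least its value at t + h. This bounds
  -- the source below, and two integrations give the factor h².
  · intro t h ht hh hth
    have hGt := hmom.nonneg_G hν₁ hβ ha hG0 hH0 (t := t) ⟨by linarith, by linarith⟩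
    set F : ℝ → ℝ := fun t => ∫ x, fn (w t) x * expTest η 0 x with hF
    have h1 := hmom.add_le_of_le hν₁ hβ ha hG0 hH0 (t := t) (r := h)
      (l := c₁ * (1 + (t + h)) ^ (-b) * F t ^ p) (by linarith) hh hth ?_
    · refine le_trans ?_ h1
      have : c₂ * (1 + (t + h)) ^ (-b) * h ^ 2 * F t ^ p
          = m₀ * (c₁ * (1 + (t + h)) ^ (-b) * F t ^ p) * h ^ 2 / 4 := by rw [hc₂]; ring
      linarith
    · intro s hs'
      have hst : s ∈ Icc 0 t₁ := ⟨by linarith [hs'.1], by linarith [hs'.2]⟩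
      have h2 := hmass ν₁ ν₂ β ε f g T w hw hs η s (by linarith [hs'.1])
        (Icc_subset_timeInterval hT hst) (by linarith [hst.2])
      refine le_trans ?_ h2
      have h3 : F t ≤ F s := hmono ⟨by linarith, by linarith⟩ hst hs'.1.le
      have h4 : F t ^ p ≤ |F s| ^ p :=
        Real.rpow_le_rpow hGt (h3.trans (le_abs_self _)) (by linarith)
      have h5 : (1 + (t + h)) ^ (-b) ≤ (1 + s) ^ (-b) :=
        Real.rpow_le_rpow_of_nonpos (by linarith [hst.1]) (by linarith [hs'.2]) (by linarith)
      have h6 : 0 ≤ F t ^ p := Real.rpow_nonneg hGt p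
      have h7 : 0 ≤ (1 + s) ^ (-b) := Real.rpow_nonneg (by linarith [hst.1]) _
      gcongr

/-- Wave-like lifespan estimate. -/
lemma exists_lifespan_le_wave (hn : 1 ≤ n) (hp : 1 < p) (hR : 1 ≤ R) (hν₁ : 0 ≤ ν₁)
    (hν₂ : ν₂ < 0) (hβ : 1 < β) (hf : 0 ≤ fn f) (hg : 0 ≤ g) (hfg : f ≠ 0 ∨ g ≠ 0)
    (hγ : 0 < gammaS p n) :
    ∃ C : ℝ, 0 < C ∧ ∀ ε : ℝ, 0 < ε → ε ≤ 1 → lifespan ν₁ ν₂ β p R ε f g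
      ≤ ENNReal.ofReal (C * ε ^ (-(2 * p * (p - 1) / gammaS p n))) := by
  obtain ⟨r, hr0, hr⟩ := exists_radius hf hg hfg
  obtain ⟨c, hc, hwave⟩ := exists_wave_bound hn hp hR hν₁ hν₂ hβ hf hg hr
  set e := ((n : ℝ) - 1) / 2 * (2 - p) with he
  set m₀ := damp ν₁ β 0 with hm₀
  have hm₀0 : 0 < m₀ := damp_pos _ _ _
  set k := min ((1 / 2 : ℝ) ^ e) (1 ^ e) with hk
  have hk0 : 0 < k := by positivity
  have hΓ : 2 - n * (p - 1) + (e + 2) * (p - 1) = gammaS p n / 2 := by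
    rw [he, gammaS]; ring
  have H := exists_lifespan_le (n := n) (c := m₀ * (c * k) / 16) (θ := p) (a := e + 2)
    hp hR hν₁ hν₂ hβ hf hg r (by positivity) (by linarith) (by rw [hΓ]; linarith) ?_
  · obtain ⟨C, hC, h⟩ := H
    refine ⟨C, hC, fun ε hε hε1 => ?_⟩
    have := h ε hε hε1
    rw [hΓ] at this
    have e1 : p * (p - 1) / (gammaS p n / 2) = 2 * p * (p - 1) / gammaS p n := by
      field_simp
    rwa [e1] at this
  · intro ε T w hε hw hs t₁ hT η hη hrη t ht
    have ht0 : 0 < t := by linarith [ht.1]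
    have ha : 0 ≤ -ν₂ := by linarith
    have hmom := isMoment_of_isEnergySolution hw hs (by linarith [ht.2]) hT hη 0
    have hG0 : 0 ≤ ∫ x, fn (w 0) x * expTest η 0 x := by
      rw [moment_init hw]
      exact mul_nonneg hε.le (integral_mul_expTest_nonneg hf η 0)
    have hH0 : 0 ≤ ∫ x, timeDeriv T w 0 x * expTest η 0 x := by
      rw [moment_init_deriv hw]
      exact mul_nonneg hε.le (integral_mul_expTest_nonneg hg η 0)
    -- The source is bounded below on [t/2, t], where s^e is comparable to t^e. Since t ≥ 2, this
    -- interval lies in the range s ≥ 1 of the wave bound.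
    have h1 := hmom.add_le_of_le hν₁ hβ ha hG0 hH0 (t := t / 2) (r := t / 2)
      (l := c * ε ^ p * (k * t ^ e)) (by linarith) (by linarith) (by linarith [ht.2]) ?_
    · have h2 := hmom.nonneg_G hν₁ hβ ha hG0 hH0 (t := t / 2)
        ⟨by linarith, by linarith [ht.2]⟩
      rw [add_halves] at h1
      have h3 : t ^ (e + 2) = t ^ e * t ^ 2 := by
        rw [Real.rpow_add ht0, Real.rpow_two]
      have h4 : m₀ * (c * k) / 16 * ε ^ p * (t ^ e * t ^ 2)
          = m₀ * (c * ε ^ p * (k * t ^ e)) * (t / 2) ^ 2 / 4 := by ring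
      rw [h3, h4]
      linarith
    · intro s hs'
      rw [add_halves] at hs'
      have h2 := hwave ε T w hε hw hs t₁ hT η hη hrη s
        ⟨by linarith [hs'.1, ht.1], by linarith [hs'.2, ht.2]⟩
      refine le_trans ?_ h2
      have h3 := min_rpow_mul_le (x := s) (y := t) (a := 1 / 2) (b := 1) (e := e) ht0 (by norm_num)
        (by linarith [hs'.1]) (by linarith [hs'.2])
      gcongr

/-- Heat-like lifespan estimate. -/
lemma exists_lifespan_le_heat (hp : 1 < p) (hR : 1 ≤ R) (hν₁ : 0 ≤ ν₁)
    (hν₂ : ν₂ < 0) (hβ : 1 < β) (hf : 0 ≤ fn f) (hg : 0 ≤ g) (hfg : f ≠ 0 ∨ g ≠ 0)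
    (hγ : 0 < gammaF p (n - (1 + √(delta ν₁ ν₂ β)) / 2)) :
    ∃ C : ℝ, 0 < C ∧ ∀ ε : ℝ, 0 < ε → ε ≤ 1 → lifespan ν₁ ν₂ β p R ε f g
      ≤ ENNReal.ofReal
        (C * ε ^ (-((p - 1) / gammaF p (n - (1 + √(delta ν₁ ν₂ β)) / 2)))) := by
  obtain ⟨r, hr0, hr⟩ := exists_radius hf hg hfg
  set I := ∫ x in Metric.closedBall (0 : Space n) r, (fn f + g) x with hI
  set m₀ := damp ν₁ β 0 with hm₀
  have hm₀0 : 0 < m₀ := damp_pos _ _ _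
  set δ := delta ν₁ ν₂ β with hδ
  have hδ1 : 1 < δ := one_lt_delta hν₂
  set k := (1 + √δ) / 2 with hk
  have hk1 : 1 < k := by
    have : 1 < √δ := by rwa [Real.lt_sqrt zero_le_one, one_pow]
    rw [hk]; linarith
  -- This is how δ is chosen: k(k−1) = (δ−1)/4.
  have hak : m₀ * -ν₂ = k * (k - 1) := by
    have h1 : √δ ^ 2 = δ := Real.sq_sqrt (by linarith)
    have h2 : δ = 1 - 4 * ν₂ * m₀ := by rw [hδ, delta, hm₀, damp_zero]
    rw [hk]
    linear_combination (-1 / 4) * h1 - h2 / 4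
  have hΓ : 2 - n * (p - 1) + k * (p - 1) = gammaF p (n - k) := by
    rw [gammaF]; ring
  set c := min m₀ (k - 1) * (Real.exp (-(2 * r)) * I) / (2 * (2 * k - 1)) with hc
  have hmin : 0 < min m₀ (k - 1) := lt_min hm₀0 (by linarith)
  have h2k : 0 < 2 * (2 * k - 1) := by linarith
  have H := exists_lifespan_le (n := n) (c := c) (θ := 1) (a := k)
    hp hR hν₁ hν₂ hβ hf hg r (by positivity) zero_le_one (by rw [hΓ]; exact hγ) ?_
  · obtain ⟨C, hC, h⟩ := H
    refine ⟨C, hC, fun ε hε hε1 => ?_⟩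
    have := h ε hε hε1
    rwa [hΓ, one_mul] at this
  · intro ε T w hε hw hs t₁ hT η hη hrη t ht
    have ha : 0 ≤ -ν₂ := by linarith
    have hmom := isMoment_of_isEnergySolution hw hs (by linarith [ht.1, ht.2]) hT hη 0
    rw [norm_zero] at hmom
    have hF0 := integral_mul_expTest_nonneg hf η 0
    have hL0 := integral_mul_expTest_nonneg hg η 0
    have h1 := hmom.rpow_le_of_mass hν₁ hβ ha (by rw [moment_init hw]; positivity)
      (by rw [moment_init_deriv hw]; positivity) hk1 hak (t := t) ⟨by linarith [ht.1], ht.2⟩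
    refine le_trans ?_ h1
    rw [moment_init hw, moment_init_deriv hw, Real.rpow_one]
    have h2 := exp_mul_integral_le hf hg hrη (ξ := 0) (by simp)
    have ht0 : 0 ≤ t := by linarith [ht.1]
    have h3 : t ^ k ≤ (1 + t) ^ k := Real.rpow_le_rpow ht0 (by linarith) (by linarith)
    set X := ∫ x, fn f x * expTest η 0 x
    set Y := ∫ x, g x * expTest η 0 x
    -- Since k > 1, both data enter with positive weight, so it suffices that one of them is
    -- non-zero.
    have h4 : min m₀ (k - 1) * (Real.exp (-(2 * r)) * I) ≤ m₀ * Y + (k - 1) * X := by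
      calc _ ≤ min m₀ (k - 1) * (Y + X) := by gcongr
        _ = min m₀ (k - 1) * Y + min m₀ (k - 1) * X := mul_add _ _ _
        _ ≤ _ := by
          gcongr
          · exact min_le_left _ _
          · exact min_le_right _ _
    have h5 : c * ε ≤ (m₀ * (ε * Y) + (k - 1) * (ε * X)) / (2 * (2 * k - 1)) := by
      rw [hc, div_mul_eq_mul_div]
      gcongr
      calc _ ≤ (m₀ * Y + (k - 1) * X) * ε := by gcongr
        _ = _ := by ring
    gcongr

end solution

end NegMass

end

/-! ### Choice between the heat-like and the wave-like lifespan bound -/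

theorem theorem1p5 (n : ℕ) (hn : 1 ≤ n) (ν₁ ν₂ β δ : ℝ) (hν₁ : 0 ≤ ν₁) (hν₂ : ν₂ < 0)
    (hβ : 1 < β) (hδ : δ = NegMass.delta ν₁ ν₂ β) :
    1 < δ ∧
    (0 ≤ NegMass.dStar n ∧ NegMass.dStar n < 2) ∧
    ((2 ≤ n → √δ ≤ n - NegMass.dStar n → NegMass.pDelta δ n = NegMass.pS n) ∧
      (2 ≤ n → n - NegMass.dStar n < √δ → √δ < 2 * n - 1 →
        NegMass.pDelta δ n = NegMass.pF (n - (1 + √δ) / 2)) ∧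
      (n = 1 ∨ (2 ≤ n ∧ 2 * n - 1 ≤ √δ) → NegMass.pDelta δ n = ⊤)) ∧
    ∀ (p : ℝ), 1 < p → (p : EReal) < NegMass.pDelta δ n →
    ∀ (f : NegMass.H1 n) (g : NegMass.L2 n), 0 ≤ NegMass.fn f → 0 ≤ g → (f ≠ 0 ∨ g ≠ 0) →
    ∀ (R : ℝ), 1 ≤ R →
    ∃ ε₅ : ℝ, 0 < ε₅ ∧ ∃ C : ℝ, 0 < C ∧ ∀ ε : ℝ, 0 < ε → ε ≤ ε₅ →
      (√δ ≤ n - 2 →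
        NegMass.lifespan ν₁ ν₂ β p R ε f g
          ≤ ENNReal.ofReal (C * ε ^ (-(2 * p * (p - 1) / NegMass.gammaS p n)))) ∧
      (n - 2 < √δ → √δ < n - NegMass.dStar n →
        (p ≤ 2 / (n - √δ) →
          NegMass.lifespan ν₁ ν₂ β p R ε f g
            ≤ ENNReal.ofReal
                (C * ε ^ (-((p - 1) / NegMass.gammaF p (n - (1 + √δ) / 2))))) ∧
        (2 / (n - √δ) < p →
          NegMass.lifespan ν₁ ν₂ β p R ε f g
            ≤ ENNReal.ofReal (C * ε ^ (-(2 * p * (p - 1) / NegMass.gammaS p n))))) ∧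
      (n - NegMass.dStar n ≤ √δ →
        NegMass.lifespan ν₁ ν₂ β p R ε f g
            ≤ ENNReal.ofReal
                (C * ε ^ (-((p - 1) / NegMass.gammaF p (n - (1 + √δ) / 2)))) ∧
        ε ^ (-((p - 1) / NegMass.gammaF p (n - (1 + √δ) / 2)))
          = ε ^ (-(2 / (p - 1) - n + (1 + √δ) / 2)⁻¹)) := by
  have hn1 : (1 : ℝ) ≤ n := by exact_mod_cast hn
  have hn2 : 2 ≤ n → (1 : ℝ) < n := fun h => by exact_mod_cast h
  have hδ1 : 1 < δ := hδ ▸ NegMass.one_lt_delta hν₂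
  have hd := NegMass.dStar_mem hn1
  refine ⟨hδ1, hd, ⟨fun h => NegMass.pDelta_eq_pS (hn2 h),
    fun h => NegMass.pDelta_eq_pF (hn2 h), ?_⟩, ?_⟩
  · rintro (rfl | ⟨-, h⟩)
    · exact NegMass.pDelta_eq_top (Or.inl (by norm_num))
    · exact NegMass.pDelta_eq_top (Or.inr h)
  · intro p hp hpδ f g hf hg hfg R hR
    have hheat : 0 < NegMass.gammaF p (n - (1 + √δ) / 2) → ∃ C : ℝ, 0 < C ∧ ∀ ε : ℝ, 0 < ε →
        ε ≤ 1 → NegMass.lifespan ν₁ ν₂ β p R ε f g ≤ ENNReal.ofReal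
          (C * ε ^ (-((p - 1) / NegMass.gammaF p (n - (1 + √δ) / 2)))) := by
      subst hδ
      exact NegMass.exists_lifespan_le_heat hp hR hν₁ hν₂ hβ hf hg hfg
    have hwave : 0 < NegMass.gammaS p n → ∃ C : ℝ, 0 < C ∧ ∀ ε : ℝ, 0 < ε →
        ε ≤ 1 → NegMass.lifespan ν₁ ν₂ β p R ε f g ≤ ENNReal.ofReal
          (C * ε ^ (-(2 * p * (p - 1) / NegMass.gammaS p n))) :=
      NegMass.exists_lifespan_le_wave hn hp hR hν₁ hν₂ hβ hf hg hfg
    rcases le_or_gt (n - NegMass.dStar n) (√δ) with hcase | hcase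
    · have hγ := NegMass.gammaF_pos_of_le_sqrt hn1 hp hpδ hcase
      obtain ⟨C, hC, h⟩ := hheat hγ
      -- The threshold ε₅ = 1 always suffices. Here √δ ≤ n − 2 is excluded because d_*(n) < 2.
      refine ⟨1, one_pos, C, hC, fun ε hε hε1 => ⟨fun h' => ?_, fun _ h' => ?_, fun _ =>
        ⟨h ε hε hε1, ?_⟩⟩⟩
      · linarith [hd.2]
      · linarith
      · have hp1 : p - 1 ≠ 0 := by linarith
        have e : 2 / (p - 1) - n + (1 + √δ) / 2
            = NegMass.gammaF p (n - (1 + √δ) / 2) / (p - 1) := by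
          rw [NegMass.gammaF]
          field_simp
          ring
        rw [e, inv_div]
    · have hnδ : 0 < n - √δ := by linarith [hd.1]
      rcases le_or_gt p (2 / (n - √δ)) with hp2 | hp2
      · have hp2' := (le_div_iff₀ hnδ).1 hp2
        obtain ⟨C, hC, h⟩ := hheat (NegMass.gammaF_pos_of_lt_pDelta hn1 hp hpδ hp2')
        refine ⟨1, one_pos, C, hC, fun ε hε hε1 => ⟨fun h' => ?_, fun _ _ =>
          ⟨fun _ => h ε hε hε1, fun h' => ?_⟩, fun h' => ?_⟩⟩
        -- If √δ ≤ n − 2, then p(n − √δ) ≥ 2p > 2, so the heat-like regime does not occur.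
        · nlinarith
        · linarith
        · linarith
      · have hp2' := (div_lt_iff₀ hnδ).1 hp2
        obtain ⟨C, hC, h⟩ := hwave (NegMass.gammaS_pos_of_lt_pDelta hn1 hp hpδ hp2'.le)
        exact ⟨1, one_pos, C, hC, fun ε hε hε1 => ⟨fun _ => h ε hε hε1, fun _ _ =>
          ⟨fun h' => by linarith, fun _ => h ε hε hε1⟩, fun h' => by linarith⟩⟩
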